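/- **Proposition.** Let $f:\mathbb R\to\mathbb R$ be smooth and put $$F(t)=\int_0^t \exp\Big(-\int_0^s f(\sigma)\,d\sigma\Big)\,ds ,$$ a strictly increasing function, with limits $F(\pm\infty)$ at $\pm\infty$. Let $u_0,u_1:\mathbb R^3\to\mathbb R$ be smooth and consider the Cauchy problem $$u_{tt}-\Delta u=f(u)\,(u_t^2-|\nabla u|^2),\qquad u(0)=u_0,\quad u_t(0)=u_1. \tag{1}$$ Say that $(u_0,u_1)$ *decays* if $u_0(x)$, $\nabla u_0(x)$, $u_1(x)$, $\nabla u_1(x)$ all tend to $0$ as $|x|\to\infty$. $L^{3/2,1}$ denotes the Lorentz space on $\mathbb R^3$. 1. If $F(-\infty)=-\infty$ and $F(+\infty)=+\infty$, then (1) has a smooth solution $u$ on $\mathbb R^{3+1}$. If in addition $(u_0,u_1)$ decays and $D^2u_0,\nabla u_1\in L^{3/2,1}$, then $u\in L^\infty_{t,x}$. 2. Let $F(-\infty)=a\in\mathbb R$ and $F(+\infty)=+\infty$. (a) If $\inf u_0>-\infty$ and $u_1\ge|\nabla u_0|$, then (1) has a smooth solution $u$ on $\mathbb R^3\times[0,\infty)$,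 with $u\ge\inf u_0$. (b) If $(u_0,u_1)$ decays and $$-\Delta u_0+f(u_0)|\nabla u_0|^2\ \ge\ |\nabla u_1-f(u_0)u_1\nabla u_0|,$$ then (1) has a smooth solution $u$ on $\mathbb R^{3+1}$, with $u\ge0$. If in addition $D^2u_0,\nabla u_1\in L^{3/2,1}$, then $u\in L^\infty_{t,x}$. 3. Let $F(-\infty)=-\infty$ and $F(+\infty)=b\in\mathbb R$. (a) If $\sup u_0<\infty$ and $-u_1\ge|\nabla u_0|$, then (1) has a smooth solution $u$ on $\mathbb R^3\times[0,\infty)$, with $u\le\sup u_0$. (b) If $(u_0,u_1)$ decays and $$\Delta u_0-f(u_0)|\nabla u_0|^2\ \ge\ |\nabla u_1-f(u_0)u_1\nabla u_0|,$$ then (1) has a smooth solution $u$ on $\mathbb R^{3+1}$, with $u\le0$. If in addition $D^2u_0,\nabla u_1\in L^{3/2,1}$, then $u\in L^\infty_{t,x}$. -/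

import Mathlib

open Set Filter Topology MeasureTheory
open scoped ENNReal ContDiff

noncomputable section

namespace NullForm

/-- Three-dimensional Euclidean space. -/
abbrev R3 : Type := EuclideanSpace ℝ (Fin 3)

/-- The auxiliary function `F(t) = ∫₀ᵗ exp (-∫₀ˢ f(σ) dσ) ds`. -/
def auxF (f : ℝ → ℝ) (t : ℝ) : ℝ :=
  ∫ s in (0 : ℝ)..t, Real.exp (-∫ σ in (0 : ℝ)..s, f σ)

/-- `u` (a function of time and space) is a smooth classical solution on `I × ℝ³` of
`u_tt - Δu = f(u) (u_t² - |∇u|²)`, `u(0) = u₀`, `u_t(0) = u₁`.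
Time derivatives are taken within `I`, so for `I = univ` they are the ordinary ones, and for
`I = [0, ∞)` they are one-sided at `t = 0`. -/
structure IsSmoothSolution (f : ℝ → ℝ) (u₀ u₁ : R3 → ℝ) (I : Set ℝ) (u : ℝ → R3 → ℝ) :
    Prop where
  smooth : ContDiffOn ℝ ∞ (fun p : ℝ × R3 => u p.1 p.2) (I ×ˢ univ)
  equation : ∀ t ∈ I, ∀ x : R3,
    derivWithin (fun s => derivWithin (fun r => u r x) I s) I t - Laplacian.laplacian (u t) x
      = f (u t x) * ((derivWithin (fun s => u s x) I t) ^ 2 - ‖gradient (u t) x‖ ^ 2)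
  initial_value : ∀ x, u 0 x = u₀ x
  initial_velocity : ∀ x, derivWithin (fun s => u s x) I 0 = u₁ x

/-- The (quasi-)norm of the Lorentz space `L^{p,q}`, `0 < p, q < ∞`, written with the distribution
function: `p^{1/q} (∫₀^∞ (s · μ{|g| > s}^{1/p})^q ds/s)^{1/q}`. It equals
`(∫₀^∞ (t^{1/p} g*(t))^q dt/t)^{1/q}`, with `g*` the decreasing rearrangement of `g`. -/
def lorentzNorm {α G : Type*} [MeasurableSpace α] [NormedAddCommGroup G]
    (g : α → G) (p q : ℝ) (μ : Measure α) : ℝ≥0∞ :=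
  ENNReal.ofReal p ^ (1 / q) *
    (∫⁻ s in Ioi (0 : ℝ),
      (ENNReal.ofReal s * μ {x | s < ‖g x‖} ^ (1 / p)) ^ q * ENNReal.ofReal s⁻¹) ^ (1 / q)

/-- Membership in the Lorentz space `L^{p,q}`. -/
def MemLorentz {α G : Type*} [MeasurableSpace α] [NormedAddCommGroup G]
    (g : α → G) (p q : ℝ) (μ : Measure α) : Prop :=
  AEStronglyMeasurable g μ ∧ lorentzNorm g p q μ < ⊤

/-- `D²u₀` and `∇u₁` belong to `L^{3/2,1}(ℝ³)`. -/
def LorentzData (u₀ u₁ : R3 → ℝ) : Prop :=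
  MemLorentz (iteratedFDeriv ℝ 2 u₀) (3 / 2) 1 volume ∧
    MemLorentz (gradient u₁) (3 / 2) 1 volume

/-- `g` decays at infinity together with its derivatives: `g(x) → 0` and `∇g(x) → 0` as
`|x| → ∞` (nothing is asked of the derivatives of higher order, and no rate). -/
def DecaysAtInfinity (g : R3 → ℝ) : Prop :=
  Tendsto g (cocompact R3) (𝓝 0) ∧ Tendsto (gradient g) (cocompact R3) (𝓝 0)

/-- `u ∈ L^∞_{t,x}(ℝ³⁺¹)`, for continuous `u`. -/
def IsBoundedSpacetime (u : ℝ → R3 → ℝ) : Prop :=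
  ∃ C : ℝ, ∀ t x, |u t x| ≤ C

end NullForm

end

/-!
The function `F` satisfies `F' > 0` and `F'' = -f F'`, so that
`□F(u) = F'(u) (□u - f(u) (u_t² - |∇u|²))` with `□ = ∂_t² - Δ`. Hence `u` solves the nonlinear
problem exactly when `v = F(u)` is the free wave with data `v₀ = F(u₀)`, `v₁ = F'(u₀) u₁`. So the
solution has to be `F⁻¹(v)`, which is defined and smooth as soon as `v` takes its values in the
range of `F`, an open interval (`exists_isSmoothSolution_of_box`). Everything else concerns
the free wave, for which Kirchhoff's formula `v = ∂_t (t M_t v₀) + t M_t v₁` with the spherical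
means `M_t` is used.

* Kirchhoff's formula solves the wave equation (`box_freeWave`). The point is the identity
  `∂_t² (t M_t g) = t M_t Δg`. It holds because the spherical part of the Laplacian is a sum of
  squares of infinitesimal rotations, each of which integrates to zero over the sphere by
  rotation invariance (`integral_sphere_fderiv_skew`, `integral_sphere_laplacian`).
* If `v₁ ≥ |∇v₀|`, then for `t ≥ 0` the wave is the mean of `v₀ + t (∂_ν v₀ + v₁) ≥ v₀`, so it stays
  above `inf v₀` (`le_freeWave_of_gradient_le`). The condition is `u₁ ≥ |∇u₀|` multiplied by
  `F'(u₀)`.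
* If `-Δv₀ ≥ |∇v₁|` and the data vanish at infinity, then `v ≥ 0`: for fixed `t ≥ 0` the function
  `s ↦ ∂_s (s M_s v₀) ± t M_s v₁` is nonincreasing for `s ≥ t`. Its first summand is nonnegative, by
  concavity of `s M_s v₀`, and its second tends to zero (`freeWave_nonneg_of_laplacian`). The
  condition is again the one on `(u₀, u₁)` multiplied by `F'(u₀)`.
* If `h → 0` at infinity, then `t M_t |h| (x)` is at most a constant times `∫ |Dh(y)| / |x - y| dy`,
  by integration along outward rays, and this potential is bounded by the `L^{3/2,1}` norm of `Dh`,
  by the layer cake formula and `∫_E dy / |x - y| ≤ C |E|^{2/3}`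
  (`exists_bound_sphericalMean_norm`). This is applied to `h = ∇u₀` and `h = u₁`; since `F'(u₀)` is
  bounded, `|∇v₀| ≤ C |∇u₀|` and `|v₁| ≤ C |u₁|`, so that `v` is bounded without any estimate of the
  second derivatives of `F(u₀)`.

The case `F(+∞) < ∞` follows from the bounds for `-v`, which is the free wave with data
`(-v₀, -v₁)`.
-/

noncomputable section

namespace NullForm

/-! ### Integrals over a compact space depending on a parameter -/

theorem integrable_of_continuous_compact {X F : Type*} [TopologicalSpace X] [CompactSpace X]
    [T2Space X] [SecondCountableTopology X] [MeasurableSpace X] [BorelSpace X]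
    [NormedAddCommGroup F] {μ : Measure X} [IsFiniteMeasure μ] {g : X → F}
    (hg : Continuous g) : Integrable g μ := by
  simpa using hg.continuousOn.integrableOn_compact (μ := μ) isCompact_univ

section ParametricIntegral

variable {P V F X : Type} [NormedAddCommGroup P] [NormedSpace ℝ P] [ProperSpace P]
  [NormedAddCommGroup V] [NormedSpace ℝ V] [NormedAddCommGroup F] [NormedSpace ℝ F]
  [TopologicalSpace X] [CompactSpace X] [T2Space X] [SecondCountableTopology X]
  [MeasurableSpace X] [BorelSpace X]

theorem hasFDerivAt_integral_of_continuous (μ : Measure X) [IsFiniteMeasure μ]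
    {G : P → X → F} {G' : P → X → P →L[ℝ] F} (hG : ∀ p, Continuous (G p))
    (hG' : Continuous (Function.uncurry G')) (h : ∀ p θ, HasFDerivAt (G · θ) (G' p θ) p) (p : P) :
    HasFDerivAt (fun q => ∫ θ, G q θ ∂μ) (∫ θ, G' p θ ∂μ) p := by
  -- compactness of the closed unit ball about `p` and of `X` gives the dominating constant
  obtain ⟨C, hC⟩ := ((isCompact_closedBall p 1).prod
    (isCompact_univ (X := X))).exists_bound_of_continuousOn hG'.continuousOn
  have hc : Continuous (G' p) := hG'.comp (by fun_prop : Continuous fun θ => (p, θ))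
  refine hasFDerivAt_integral_of_dominated_of_fderiv_le (bound := fun _ => C)
    (Metric.closedBall_mem_nhds p one_pos)
    (Eventually.of_forall fun q => (integrable_of_continuous_compact (hG q)).aestronglyMeasurable)
    (integrable_of_continuous_compact (hG p))
    (integrable_of_continuous_compact hc).aestronglyMeasurable
    (Eventually.of_forall fun θ q hq => hC (q, θ) ⟨hq, mem_univ _⟩)
    (integrable_const C) (Eventually.of_forall fun θ q _ => h q θ)

theorem hasFDerivAt_integral_of_contDiff (μ : Measure X) [IsFiniteMeasure μ] {G : P × V → F}
    (hG : ContDiff ℝ 1 G) {a : X → V} (ha : Continuous a) (p : P) :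
    HasFDerivAt (fun q => ∫ θ, G (q, a θ) ∂μ)
      (∫ θ, (fderiv ℝ G (p, a θ)).comp (.inl ℝ P V) ∂μ) p := by
  have hd : Continuous (fderiv ℝ G) := hG.continuous_fderiv one_ne_zero
  refine hasFDerivAt_integral_of_continuous μ (G := fun q θ => G (q, a θ))
    (G' := fun q θ => (fderiv ℝ G (q, a θ)).comp (.inl ℝ P V)) (fun p => ?_) ?_ (fun p θ => ?_) p
  · exact hG.continuous.comp (by fun_prop)
  · have : Continuous fun z : P × X => fderiv ℝ G (z.1, a z.2) := hd.comp (by fun_prop)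
    exact this.clm_comp continuous_const
  · exact ((hG.differentiable one_ne_zero) (p, a θ)).hasFDerivAt.comp p
      (hasFDerivAt_prodMk_left p (a θ))

/-- The target space `F` varies in the induction, since `fderiv` replaces it by `P →L[ℝ] F`. -/
theorem contDiff_integral_nat (μ : Measure X) [IsFiniteMeasure μ] {a : X → V} (ha : Continuous a)
    (n : ℕ) : ∀ {F : Type} [NormedAddCommGroup F] [NormedSpace ℝ F] {G : P × V → F},
      ContDiff ℝ ∞ G → ContDiff ℝ n fun p => ∫ θ, G (p, a θ) ∂μ := by
  induction n with
  | zero =>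
    intro F _ _ G hG
    have h := hasFDerivAt_integral_of_contDiff μ (hG.of_le (by simp)) ha
    exact contDiff_zero.2 (continuous_iff_continuousAt.2 fun p => (h p).continuousAt)
  | succ n ih =>
    intro F _ _ G hG
    have h := hasFDerivAt_integral_of_contDiff μ (hG.of_le (by simp)) ha
    push_cast
    rw [contDiff_succ_iff_fderiv]
    refine ⟨fun p => (h p).differentiableAt, by simp, ?_⟩
    have hG' : ContDiff ℝ ∞ fun z : P × V => (fderiv ℝ G z).comp (.inl ℝ P V) :=
      (hG.fderiv_right (m := ∞) (by simp)).clm_comp contDiff_const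
    rw [show (fderiv ℝ fun p => ∫ θ, G (p, a θ) ∂μ) = _ from funext fun p => (h p).fderiv]
    exact ih hG'

theorem contDiff_integral (μ : Measure X) [IsFiniteMeasure μ] {a : X → V} (ha : Continuous a)
    {G : P × V → F} (hG : ContDiff ℝ ∞ G) : ContDiff ℝ ∞ fun p => ∫ θ, G (p, a θ) ∂μ :=
  contDiff_infty.2 fun n => contDiff_integral_nat μ ha n hG

end ParametricIntegral

/-! ### The rotation-invariant probability on the unit sphere -/

/-- The unit sphere of `ℝ³`. -/
abbrev S2 : Type := Metric.sphere (0 : R3) 1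

instance : NeZero (volume : Measure R3).toSphere := ⟨Measure.toSphere_ne_zero _⟩

/-- The surface measure of the unit sphere, normalised to total mass one. -/
def sphereProb : Measure S2 :=
  ((volume : Measure R3).toSphere univ)⁻¹ • (volume : Measure R3).toSphere

instance : IsProbabilityMeasure sphereProb := isProbabilityMeasureSMul

theorem norm_sphere (θ : S2) : ‖(θ : R3)‖ = 1 := by simp

/-- The action of a linear isometry on the unit sphere. -/
def sphereMap (L : R3 ≃ₗᵢ[ℝ] R3) (θ : S2) : S2 := ⟨L θ, by simp⟩

open scoped Pointwise in
/-- Cones over subsets of the sphere are mapped to cones, and `L` preserves the volume. -/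
theorem measurePreserving_sphereMap (L : R3 ≃ₗᵢ[ℝ] R3) :
    MeasurePreserving (sphereMap L) sphereProb sphereProb := by
  have hc : Continuous (sphereMap L) :=
    (L.continuous.comp continuous_subtype_val).subtype_mk _
  refine ⟨hc.measurable, ?_⟩
  rw [sphereProb, Measure.map_smul]
  congr 1
  ext s hs
  rw [Measure.map_apply hc.measurable hs, Measure.toSphere_apply' _ (hc.measurable hs),
    Measure.toSphere_apply' _ hs]
  congr 1
  have : Ioo (0 : ℝ) 1 • ((↑) '' (sphereMap L ⁻¹' s) : Set R3) =
      L ⁻¹' (Ioo (0 : ℝ) 1 • ((↑) '' s : Set R3)) := by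
    ext y
    simp only [Set.mem_smul, mem_image, mem_preimage, Subtype.exists]
    constructor
    · rintro ⟨r, hr, z, ⟨w, hw, hws, rfl⟩, rfl⟩
      exact ⟨r, hr, L w, ⟨L w, by simpa using hw, hws, rfl⟩, by simp⟩
    · rintro ⟨r, hr, z, ⟨w, hw, hws, rfl⟩, h⟩
      refine ⟨r, hr, L.symm w, ⟨L.symm w, by simpa using hw, ?_, rfl⟩, ?_⟩
      · simpa [sphereMap] using hws
      · rw [← map_smul, h]; simp
  rw [this]
  exact MeasurePreserving.measure_preimage_equiv (f := L.toHomeomorph.toMeasurableEquiv)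
    L.measurePreserving _

theorem integral_sphere_comp_isometry {F : Type*} [NormedAddCommGroup F] [NormedSpace ℝ F]
    (L : R3 ≃ₗᵢ[ℝ] R3) {k : R3 → F} (hk : Continuous k) :
    ∫ θ : S2, k (L θ) ∂sphereProb = ∫ θ : S2, k θ ∂sphereProb := by
  have h := measurePreserving_sphereMap L
  have := integral_map (μ := sphereProb) h.measurable.aemeasurable (f := fun θ : S2 => k θ)
    (by
      rw [h.map_eq]
      exact (integrable_of_continuous_compact
        (hk.comp continuous_subtype_val)).aestronglyMeasurable)
  rw [h.map_eq] at this
  exact this.symm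

/-- The integral over the sphere of the derivative of a function along an infinitesimal rotation
vanishes: the rotations `exp (sA)` preserve the measure, and the derivative at `s = 0` of the
constant `∫ k (exp (sA) θ)` is the integral in question. -/
theorem integral_sphere_fderiv_skew {k : R3 → ℝ} (hk : ContDiff ℝ 1 k) {A : R3 →L[ℝ] R3}
    (hA : A ∈ skewAdjoint (R3 →L[ℝ] R3)) :
    ∫ θ : S2, fderiv ℝ k θ (A θ) ∂sphereProb = 0 := by
  -- the exponential of a Banach algebra is set up over `ℚ`
  let _ : NormedAlgebra ℚ (R3 →L[ℝ] R3) := NormedAlgebra.restrictScalars ℚ ℝ _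
  let R : ℝ → R3 →L[ℝ] R3 := fun s => NormedSpace.exp (s • A)
  have hRc : Continuous R := NormedSpace.exp_continuous.comp (by fun_prop)
  have hRd : ∀ s, HasDerivAt R (A * R s) s := fun s => hasDerivAt_exp_smul_const' A s
  have hinv : ∀ s, ∫ θ : S2, k (R s θ) ∂sphereProb = ∫ θ : S2, k θ ∂sphereProb := by
    intro s
    have hu : R s ∈ unitary (R3 →L[ℝ] R3) :=
      NormedSpace.exp_mem_unitary_of_mem_skewAdjoint (skewAdjoint.smul_mem s hA)
    exact integral_sphere_comp_isometry (Unitary.linearIsometryEquiv ⟨R s, hu⟩) hk.continuous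
  have hkd : Continuous (fderiv ℝ k) := hk.continuous_fderiv one_ne_zero
  have hd := hasFDerivAt_integral_of_continuous sphereProb
    (G := fun (s : ℝ) (θ : S2) => k (R s θ))
    (G' := fun s θ => ContinuousLinearMap.toSpanSingleton ℝ (fderiv ℝ k (R s θ) (A (R s θ))))
    (fun s => hk.continuous.comp (by fun_prop))
    (by
      have h1 : Continuous fun z : ℝ × S2 => R z.1 (z.2 : R3) :=
        (hRc.comp continuous_fst).clm_apply (by fun_prop)
      have h2 : Continuous fun z : ℝ × S2 => fderiv ℝ k (R z.1 z.2) (A (R z.1 z.2)) :=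
        (hkd.comp h1).clm_apply (A.continuous.comp h1)
      exact (ContinuousLinearMap.toSpanSingletonCLE (𝕜 := ℝ) (E := ℝ)).continuous.comp h2)
    (fun s θ => by
      have h1 : HasDerivAt (fun s => R s (θ : R3)) ((A * R s) θ) s := by
        simpa using (hRd s).clm_apply (hasDerivAt_const s (θ : R3))
      exact ((hk.differentiable one_ne_zero (R s θ)).hasFDerivAt.comp_hasDerivAt s h1).hasFDerivAt)
    0
  have hR0 : R 0 = 1 := by
    change NormedSpace.exp ((0 : ℝ) • A) = 1
    rw [show (0 : ℝ) • A = 0 by ext; simp, NormedSpace.exp_zero]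
  rw [funext hinv] at hd
  have h0 := (hasFDerivAt_const _ _).unique hd
  have h1 := congrArg (fun T : ℝ →L[ℝ] ℝ => T 1) h0
  rw [ContinuousLinearMap.integral_apply] at h1
  · simpa [hR0] using h1.symm
  · refine integrable_of_continuous_compact ?_
    have h2 : Continuous fun θ : S2 => fderiv ℝ k (R 0 θ) (A (R 0 θ)) :=
      (hkd.comp ((R 0).continuous.comp continuous_subtype_val)).clm_apply
        (A.continuous.comp ((R 0).continuous.comp continuous_subtype_val))
    exact (ContinuousLinearMap.toSpanSingletonCLE (𝕜 := ℝ) (E := ℝ)).continuous.comp h2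

/-! ### Directional derivatives -/

section DirDeriv

variable {E : Type*} [NormedAddCommGroup E] [NormedSpace ℝ E]

/-- The derivative of a scalar function in the fixed direction `v`. -/
def dirDeriv (v : E) (U : E → ℝ) (p : E) : ℝ := fderiv ℝ U p v

theorem contDiff_dirDeriv {U : E → ℝ} (hU : ContDiff ℝ ∞ U) (v : E) :
    ContDiff ℝ ∞ (dirDeriv v U) :=
  (hU.fderiv_right (m := ∞) (by simp)).clm_apply contDiff_const

theorem fderiv_dirDeriv {U : E → ℝ} {p : E} (hU : ContDiffAt ℝ ∞ U p) (v w : E) :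
    fderiv ℝ (dirDeriv v U) p w = fderiv ℝ (fderiv ℝ U) p w v := by
  have h : DifferentiableAt ℝ (fderiv ℝ U) p :=
    (hU.fderiv_right (m := 1) (by norm_cast)).differentiableAt one_ne_zero
  exact DFunLike.congr_fun (h.hasFDerivAt.clm_apply (hasFDerivAt_const v p)).fderiv w |>.trans
    (by simp)

theorem isSymmSndFDerivAt_of_smooth {U : E → ℝ} {p : E} (hU : ContDiffAt ℝ ∞ U p) :
    IsSymmSndFDerivAt ℝ U p :=
  hU.isSymmSndFDerivAt (by
    rw [minSmoothness_of_isRCLikeNormedField]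
    exact WithTop.coe_le_coe.2 le_top)

theorem dirDeriv_comm {U : E → ℝ} (hU : ContDiff ℝ ∞ U) (v w : E) :
    dirDeriv v (dirDeriv w U) = dirDeriv w (dirDeriv v U) := by
  ext p
  have hs : IsSymmSndFDerivAt ℝ U p := isSymmSndFDerivAt_of_smooth hU.contDiffAt
  simpa only [fderiv_dirDeriv hU.contDiffAt, dirDeriv] using hs.eq v w

theorem dirDeriv_add {U V : E → ℝ} (hU : ContDiff ℝ ∞ U) (hV : ContDiff ℝ ∞ V) (v : E) :
    dirDeriv v (fun p => U p + V p) = fun p => dirDeriv v U p + dirDeriv v V p := by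
  ext p
  simp [dirDeriv, fderiv_fun_add (hU.differentiable (by simp) p) (hV.differentiable (by simp) p)]

theorem dirDeriv_mul {U V : E → ℝ} (hU : ContDiff ℝ ∞ U) (hV : ContDiff ℝ ∞ V) (v : E) (p : E) :
    dirDeriv v (fun p => U p * V p) p = U p * dirDeriv v V p + dirDeriv v U p * V p := by
  simp [dirDeriv, fderiv_fun_mul (hU.differentiable (by simp) p) (hV.differentiable (by simp) p),
    mul_comm]

theorem dirDeriv_neg (U : E → ℝ) (v : E) :
    dirDeriv v (fun p => -U p) = fun p => -dirDeriv v U p := by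
  ext p
  simp [dirDeriv, fderiv_fun_neg]

theorem dirDeriv_sum {ι : Type*} (s : Finset ι) {U : ι → E → ℝ} (hU : ∀ i, ContDiff ℝ ∞ (U i))
    (v : E) : dirDeriv v (fun p => ∑ i ∈ s, U i p) = fun p => ∑ i ∈ s, dirDeriv v (U i) p := by
  ext p
  simp [dirDeriv, fderiv_fun_sum fun i _ => (hU i).differentiable (by simp) p]

end DirDeriv

/-- The standard basis vectors of `ℝ³`. -/
def basisVec (i : Fin 3) : R3 := EuclideanSpace.basisFun (Fin 3) ℝ i

/-- The unit vector of the time direction in `ℝ × ℝ³`. -/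
def timeVec : ℝ × R3 := (1, 0)

/-- The unit vectors of the space directions in `ℝ × ℝ³`. -/
def spaceVec (i : Fin 3) : ℝ × R3 := (0, basisVec i)

theorem laplacian_eq_sum_snd (g : R3 → ℝ) (x : R3) :
    Laplacian.laplacian g x = ∑ i, fderiv ℝ (fderiv ℝ g) x (basisVec i) (basisVec i) := by
  rw [InnerProductSpace.laplacian_eq_iteratedFDeriv_orthonormalBasis g
    (EuclideanSpace.basisFun (Fin 3) ℝ)]
  simp [iteratedFDeriv_two_apply, basisVec]

theorem laplacian_eq_sum {g : R3 → ℝ} (hg : ContDiff ℝ ∞ g) :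
    Laplacian.laplacian g = fun x => ∑ i, dirDeriv (basisVec i) (dirDeriv (basisVec i) g) x := by
  ext x
  rw [laplacian_eq_sum_snd]
  exact Finset.sum_congr rfl fun i _ => (fderiv_dirDeriv hg.contDiffAt _ _).symm

theorem contDiff_laplacian {g : R3 → ℝ} (hg : ContDiff ℝ ∞ g) :
    ContDiff ℝ ∞ (Laplacian.laplacian g : R3 → ℝ) := by
  rw [laplacian_eq_sum hg]
  exact ContDiff.sum fun i _ => contDiff_dirDeriv (contDiff_dirDeriv hg _) _

theorem sum_coord_smul_basisVec (y : R3) :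
    y = y 0 • basisVec 0 + y 1 • basisVec 1 + y 2 • basisVec 2 := by
  have := (EuclideanSpace.basisFun (Fin 3) ℝ).sum_repr y
  simpa [Fin.sum_univ_three, basisVec] using this.symm

theorem inner_basisVec (i : Fin 3) (y : R3) : inner ℝ (basisVec i) y = y i := by
  simp [basisVec, EuclideanSpace.inner_single_left]

theorem basisVec_apply (i j : Fin 3) : (basisVec i) j = if j = i then 1 else 0 := by
  simp [basisVec]

/-! ### The averages of an infinitesimal rotation -/

/-- The infinitesimal rotation `y ↦ yᵢ eⱼ - yⱼ eᵢ` in a coordinate plane. -/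
def planeRotation (i j : Fin 3) : R3 →L[ℝ] R3 :=
  (innerSL ℝ (basisVec i)).smulRight (basisVec j) - (innerSL ℝ (basisVec j)).smulRight (basisVec i)

theorem planeRotation_apply (i j : Fin 3) (y : R3) :
    planeRotation i j y = y i • basisVec j - y j • basisVec i := by
  simp [planeRotation, inner_basisVec]

theorem planeRotation_mem_skewAdjoint (i j : Fin 3) :
    planeRotation i j ∈ skewAdjoint (R3 →L[ℝ] R3) := by
  rw [skewAdjoint.mem_iff, ContinuousLinearMap.star_eq_adjoint]
  symm
  rw [ContinuousLinearMap.eq_adjoint_iff]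
  intro x y
  simp only [neg_apply, planeRotation_apply, inner_neg_left, inner_sub_left,
    inner_smul_left, inner_basisVec,
    real_inner_comm _ x, RCLike.conj_to_real]
  ring

/-- The squares of the three coordinate rotations add up to `-2` times the identity. -/
theorem sum_planeRotation_sq (l : R3 →L[ℝ] ℝ) (y : R3) :
    l (planeRotation 0 1 (planeRotation 0 1 y)) + l (planeRotation 1 2 (planeRotation 1 2 y)) +
      l (planeRotation 2 0 (planeRotation 2 0 y)) = -2 * l y := by
  conv_rhs => rw [sum_coord_smul_basisVec y]
  simp only [planeRotation_apply, basisVec_apply, map_sub, map_add,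
    map_smul, smul_eq_mul]
  simp
  ring

/-- At a unit vector `y` the three rotated vectors pick out the trace of a symmetric form on the
plane orthogonal to `y`. -/
theorem sum_bilin_planeRotation (B : R3 →L[ℝ] R3 →L[ℝ] ℝ) (hB : ∀ v w, B v w = B w v) {y : R3}
    (hy : ‖y‖ = 1) :
    B (planeRotation 0 1 y) (planeRotation 0 1 y) + B (planeRotation 1 2 y) (planeRotation 1 2 y) +
      B (planeRotation 2 0 y) (planeRotation 2 0 y) =
      ∑ i, B (basisVec i) (basisVec i) - B y y := by
  have h1 : y 0 ^ 2 + y 1 ^ 2 + y 2 ^ 2 = 1 := by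
    have := EuclideanSpace.norm_sq_eq y
    rw [hy, Fin.sum_univ_three] at this
    simpa using this.symm
  have hyy : B y y = B (y 0 • basisVec 0 + y 1 • basisVec 1 + y 2 • basisVec 2)
      (y 0 • basisVec 0 + y 1 • basisVec 1 + y 2 • basisVec 2) := by
    rw [← sum_coord_smul_basisVec y]
  rw [hyy]
  simp only [planeRotation_apply, map_sub, map_add, map_smul, smul_eq_mul, Fin.sum_univ_three,
    sub_apply, add_apply, smul_apply]
  rw [hB (basisVec 1) (basisVec 0), hB (basisVec 2) (basisVec 0), hB (basisVec 2) (basisVec 1)]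
  linear_combination (B (basisVec 0) (basisVec 0) + B (basisVec 1) (basisVec 1) +
    B (basisVec 2) (basisVec 2)) * h1

section SphericalMean

variable {g : R3 → ℝ}

theorem continuous_sphere {F : Type*} [TopologicalSpace F] {k : R3 → F} (hk : Continuous k) :
    Continuous fun θ : S2 => k θ := hk.comp continuous_subtype_val

theorem integrable_sphere {F : Type*} [NormedAddCommGroup F] {k : R3 → F} (hk : Continuous k) :
    Integrable (fun θ : S2 => k θ) sphereProb :=
  integrable_of_continuous_compact (continuous_sphere hk)

theorem contDiff_fderiv_line_apply (hg : ContDiff ℝ ∞ g) (x : R3) (t : ℝ) (A : R3 →L[ℝ] R3) :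
    ContDiff ℝ ∞ fun y => fderiv ℝ g (x + t • y) (A y) := by
  have h : ContDiff ℝ ∞ (fderiv ℝ g) := hg.fderiv_right (by simp)
  exact (h.comp (by fun_prop)).clm_apply A.contDiff

/-- The mean value over a sphere of `Δg - ∂_r²g - (2/r) ∂_r g`, the spherical part of the
Laplacian, is zero: it is a sum of squares of infinitesimal rotations. -/
theorem integral_sphere_laplacian (hg : ContDiff ℝ ∞ g) (x : R3) (t : ℝ) :
    t * ∫ θ : S2, Laplacian.laplacian g (x + t • (θ : R3)) ∂sphereProb =
      t * ∫ θ : S2, fderiv ℝ (fderiv ℝ g) (x + t • (θ : R3)) θ θ ∂sphereProb +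
        2 * ∫ θ : S2, fderiv ℝ g (x + t • (θ : R3)) θ ∂sphereProb := by
  have hd1 : ContDiff ℝ ∞ (fderiv ℝ g) := hg.fderiv_right (by simp)
  have hd2 : ContDiff ℝ ∞ (fderiv ℝ (fderiv ℝ g)) := hd1.fderiv_right (by simp)
  have hc1 := hd1.continuous
  have hc2 := hd2.continuous
  -- `integral_sphere_fderiv_skew` for `k y = Dg(x + ty)(A y)` with `A = planeRotation i j`
  have key : ∀ i j, ∫ θ : S2, (t * fderiv ℝ (fderiv ℝ g) (x + t • (θ : R3)) (planeRotation i j θ)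
      (planeRotation i j θ) + fderiv ℝ g (x + t • (θ : R3))
        (planeRotation i j (planeRotation i j θ))) ∂sphereProb = 0 := by
    intro i j
    rw [← integral_sphere_fderiv_skew ((contDiff_fderiv_line_apply hg x t (planeRotation i j)).of_le
      (by simp)) (planeRotation_mem_skewAdjoint i j)]
    refine integral_congr_ae (Eventually.of_forall fun θ => ?_)
    have h1 : HasFDerivAt (fun y : R3 => x + t • y) (t • ContinuousLinearMap.id ℝ R3) (θ : R3) :=
      ((hasFDerivAt_id _).const_smul t).const_add x
    have h2 := (((hd1.differentiable (by simp)) (x + t • (θ : R3))).hasFDerivAt.comp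
      (θ : R3) h1).clm_apply (planeRotation i j).hasFDerivAt
    have h3 := DFunLike.congr_fun h2.fderiv (planeRotation i j θ)
    simp only [Function.comp_def] at h3
    simp only [h3]
    simp
    ring
  have hi : ∀ i j, Integrable (fun θ : S2 => t * fderiv ℝ (fderiv ℝ g) (x + t • (θ : R3))
      (planeRotation i j θ) (planeRotation i j θ) + fderiv ℝ g (x + t • (θ : R3))
        (planeRotation i j (planeRotation i j θ))) sphereProb := fun i j =>
    integrable_sphere (k := fun y => t * fderiv ℝ (fderiv ℝ g) (x + t • y)
      (planeRotation i j y) (planeRotation i j y) + fderiv ℝ g (x + t • y)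
        (planeRotation i j (planeRotation i j y))) (by fun_prop)
  have hsum : ∫ θ : S2, (t * Laplacian.laplacian g (x + t • (θ : R3)) -
      t * fderiv ℝ (fderiv ℝ g) (x + t • (θ : R3)) θ θ -
        2 * fderiv ℝ g (x + t • (θ : R3)) θ) ∂sphereProb = 0 := by
    have h0 := integral_add ((hi 0 1).add (hi 1 2)) (hi 2 0)
    have h1 := integral_add (hi 0 1) (hi 1 2)
    simp only [Pi.add_apply] at h0 h1
    rw [h1, key, key, key] at h0
    simp only [add_zero] at h0
    rw [← h0]
    refine integral_congr_ae (Eventually.of_forall fun θ => ?_)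
    have hs : IsSymmSndFDerivAt ℝ g (x + t • (θ : R3)) :=
      isSymmSndFDerivAt_of_smooth hg.contDiffAt
    have e1 := sum_bilin_planeRotation (fderiv ℝ (fderiv ℝ g) (x + t • (θ : R3)))
      (fun v w => hs.eq v w) (norm_sphere θ)
    have e2 := sum_planeRotation_sq (fderiv ℝ g (x + t • (θ : R3))) θ
    simp only [laplacian_eq_sum_snd]
    linear_combination -t * e1 - e2
  have hlc : Continuous (Laplacian.laplacian g : R3 → ℝ) := (contDiff_laplacian hg).continuous
  have i1 : Integrable (fun θ : S2 => t * Laplacian.laplacian g (x + t • (θ : R3))) sphereProb :=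
    integrable_sphere (k := fun y => t * Laplacian.laplacian g (x + t • y)) (by fun_prop)
  have i2 : Integrable (fun θ : S2 => t * fderiv ℝ (fderiv ℝ g) (x + t • (θ : R3)) θ θ)
      sphereProb :=
    integrable_sphere (k := fun y => t * fderiv ℝ (fderiv ℝ g) (x + t • y) y y) (by fun_prop)
  have i3 : Integrable (fun θ : S2 => 2 * fderiv ℝ g (x + t • (θ : R3)) θ) sphereProb :=
    integrable_sphere (k := fun y => 2 * fderiv ℝ g (x + t • y) y) (by fun_prop)
  have i12 := integral_sub (i1.sub i2) i3
  simp only [Pi.sub_apply] at i12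
  rw [i12, integral_sub i1 i2, integral_const_mul, integral_const_mul,
    integral_const_mul] at hsum
  linarith

/-! ### The solution of the free wave equation -/

/-- The mean of `g` over the sphere of radius `|t|` about `x`, as a function of `p = (t, x)`. -/
def sphericalMean (g : R3 → ℝ) (p : ℝ × R3) : ℝ := ∫ θ : S2, g (p.2 + p.1 • (θ : R3)) ∂sphereProb

/-- The mean of the outward normal derivative of `g` over the sphere of radius `t` about `x`. -/
def normalMean (g : R3 → ℝ) (p : ℝ × R3) : ℝ :=
  ∫ θ : S2, fderiv ℝ g (p.2 + p.1 • (θ : R3)) θ ∂sphereProb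

theorem dirDeriv_integral_sphere {G : (ℝ × R3) × R3 → ℝ} (hG : ContDiff ℝ ∞ G) (v p : ℝ × R3) :
    dirDeriv v (fun q => ∫ θ : S2, G (q, θ) ∂sphereProb) p =
      ∫ θ : S2, fderiv ℝ G (p, θ) (v, 0) ∂sphereProb := by
  have h := hasFDerivAt_integral_of_contDiff sphereProb (hG.of_le (by simp))
    (continuous_subtype_val (p := fun x => x ∈ Metric.sphere (0 : R3) 1)) p
  have hc : Continuous (fderiv ℝ G) := hG.continuous_fderiv (by simp)
  rw [dirDeriv, h.fderiv, ContinuousLinearMap.integral_apply]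
  · simp
  · exact integrable_sphere (k := fun y => (fderiv ℝ G (p, y)).comp (.inl ℝ (ℝ × R3) R3))
      ((hc.comp (by fun_prop)).clm_comp continuous_const)

/-- The derivative of `((t, x), y) ↦ x + ty` in the directions that keep `y` fixed. -/
theorem hasFDerivAt_translate (z : (ℝ × R3) × R3) (w : ℝ × R3) :
    ∃ L : (ℝ × R3) × R3 →L[ℝ] R3, L (w, 0) = w.2 + w.1 • z.2 ∧
      HasFDerivAt (fun z : (ℝ × R3) × R3 => z.1.2 + z.1.1 • z.2) L z := by
  have h11 : HasFDerivAt (fun z : (ℝ × R3) × R3 => z.1.1)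
    ((ContinuousLinearMap.fst ℝ ℝ R3).comp (.fst ℝ _ _)) z := hasFDerivAt_fst.comp z hasFDerivAt_fst
  have h12 : HasFDerivAt (fun z : (ℝ × R3) × R3 => z.1.2)
    ((ContinuousLinearMap.snd ℝ ℝ R3).comp (.fst ℝ _ _)) z := hasFDerivAt_snd.comp z hasFDerivAt_fst
  have h2 : HasFDerivAt (fun z : (ℝ × R3) × R3 => z.2) (.snd ℝ _ _) z := hasFDerivAt_snd
  refine ⟨_, ?_, h12.add (h11.smul h2)⟩
  simp

theorem contDiff_translate (hg : ContDiff ℝ ∞ g) :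
    ContDiff ℝ ∞ fun z : (ℝ × R3) × R3 => g (z.1.2 + z.1.1 • z.2) := by
  refine hg.comp ?_
  fun_prop

theorem contDiff_sphericalMean (hg : ContDiff ℝ ∞ g) : ContDiff ℝ ∞ (sphericalMean g) :=
  contDiff_integral sphereProb continuous_subtype_val (contDiff_translate hg)

theorem contDiff_normal (hg : ContDiff ℝ ∞ g) :
    ContDiff ℝ ∞ fun z : (ℝ × R3) × R3 => fderiv ℝ g (z.1.2 + z.1.1 • z.2) z.2 := by
  have h : ContDiff ℝ ∞ (fderiv ℝ g) := hg.fderiv_right (by simp)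
  refine (h.comp ?_).clm_apply contDiff_snd
  fun_prop

theorem contDiff_normalMean (hg : ContDiff ℝ ∞ g) : ContDiff ℝ ∞ (normalMean g) :=
  contDiff_integral sphereProb continuous_subtype_val (contDiff_normal hg)

theorem dirDeriv_sphericalMean (hg : ContDiff ℝ ∞ g) (v p : ℝ × R3) :
    dirDeriv v (sphericalMean g) p =
      ∫ θ : S2, fderiv ℝ g (p.2 + p.1 • (θ : R3)) (v.2 + v.1 • (θ : R3)) ∂sphereProb := by
  refine (dirDeriv_integral_sphere (contDiff_translate hg) v p).trans ?_
  refine integral_congr_ae (Eventually.of_forall fun θ => ?_)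
  obtain ⟨L, hL, h⟩ := hasFDerivAt_translate (p, (θ : R3)) v
  have := ((hg.differentiable (by simp) _).hasFDerivAt.comp (p, (θ : R3)) h).fderiv
  simp only [Function.comp_def] at this
  simp [this, hL]

theorem dirDeriv_time_sphericalMean (hg : ContDiff ℝ ∞ g) :
    dirDeriv timeVec (sphericalMean g) = normalMean g := by
  ext p
  simp [dirDeriv_sphericalMean hg, timeVec, normalMean]

theorem dirDeriv_space_sphericalMean (hg : ContDiff ℝ ∞ g) (i : Fin 3) :
    dirDeriv (spaceVec i) (sphericalMean g) = sphericalMean (dirDeriv (basisVec i) g) := by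
  ext p
  rw [dirDeriv_sphericalMean hg]
  simp [spaceVec, sphericalMean, dirDeriv]

theorem dirDeriv_time_normalMean (hg : ContDiff ℝ ∞ g) (p : ℝ × R3) :
    dirDeriv timeVec (normalMean g) p =
      ∫ θ : S2, fderiv ℝ (fderiv ℝ g) (p.2 + p.1 • (θ : R3)) θ θ ∂sphereProb := by
  refine (dirDeriv_integral_sphere (contDiff_normal hg) timeVec p).trans ?_
  refine integral_congr_ae (Eventually.of_forall fun θ => ?_)
  obtain ⟨L, hL, h⟩ := hasFDerivAt_translate (p, (θ : R3)) timeVec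
  have hd : ContDiff ℝ ∞ (fderiv ℝ g) := hg.fderiv_right (by simp)
  have h2 : HasFDerivAt (fun z : (ℝ × R3) × R3 => z.2) (.snd ℝ _ _) (p, (θ : R3)) :=
    hasFDerivAt_snd
  have := (((hd.differentiable (by simp) _).hasFDerivAt.comp (p, (θ : R3)) h).clm_apply h2).fderiv
  simp only [Function.comp_def] at this
  simp only [timeVec, zero_add, one_smul] at hL
  simp [this, timeVec, hL]

theorem sphericalMean_add {g h : R3 → ℝ} (hg : Continuous g) (hh : Continuous h) (p : ℝ × R3) :
    sphericalMean (fun x => g x + h x) p = sphericalMean g p + sphericalMean h p :=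
  integral_add (integrable_sphere (k := fun y => g (p.2 + p.1 • y)) (by fun_prop))
    (integrable_sphere (k := fun y => h (p.2 + p.1 • y)) (by fun_prop))

/-- The solution `(t, x) ↦ t M_t g(x)` of the free wave equation with data `(0, g)`. -/
def waveProp (g : R3 → ℝ) (p : ℝ × R3) : ℝ := p.1 * sphericalMean g p

theorem contDiff_waveProp (hg : ContDiff ℝ ∞ g) : ContDiff ℝ ∞ (waveProp g) :=
  contDiff_fst.mul (contDiff_sphericalMean hg)

theorem dirDeriv_fst (v p : ℝ × R3) : dirDeriv v (fun p : ℝ × R3 => p.1) p = v.1 := by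
  have h : HasFDerivAt (fun p : ℝ × R3 => p.1) (.fst ℝ ℝ R3) p := hasFDerivAt_fst
  simp [dirDeriv, h.fderiv]

theorem dirDeriv_time_waveProp (hg : ContDiff ℝ ∞ g) :
    dirDeriv timeVec (waveProp g) = fun p => sphericalMean g p + p.1 * normalMean g p := by
  ext p
  refine (dirDeriv_mul contDiff_fst (contDiff_sphericalMean hg) timeVec p).trans ?_
  rw [dirDeriv_fst, dirDeriv_time_sphericalMean hg]
  simp [timeVec, add_comm]

/-- `∂_t² (t M_t g) = t M_t Δg`: the left-hand side is `2 ∂_t M_t g + t ∂_t² M_t g`, and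
`integral_sphere_laplacian` applies. -/
theorem dirDeriv_time_time_waveProp (hg : ContDiff ℝ ∞ g) :
    dirDeriv timeVec (dirDeriv timeVec (waveProp g)) = waveProp (Laplacian.laplacian g) := by
  rw [dirDeriv_time_waveProp hg, dirDeriv_add (contDiff_sphericalMean hg)
    (contDiff_fst.mul (contDiff_normalMean hg))]
  ext p
  rw [dirDeriv_mul contDiff_fst (contDiff_normalMean hg), dirDeriv_fst,
    dirDeriv_time_sphericalMean hg, dirDeriv_time_normalMean hg, waveProp, sphericalMean,
    integral_sphere_laplacian hg]
  simp only [timeVec, normalMean]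
  ring

theorem dirDeriv_space_waveProp (hg : ContDiff ℝ ∞ g) (i : Fin 3) :
    dirDeriv (spaceVec i) (waveProp g) = waveProp (dirDeriv (basisVec i) g) := by
  ext p
  refine (dirDeriv_mul contDiff_fst (contDiff_sphericalMean hg) (spaceVec i) p).trans ?_
  rw [dirDeriv_fst, dirDeriv_space_sphericalMean hg]
  simp [spaceVec, waveProp]

/-- The wave operator `∂_t² - Δ` on functions of space-time. -/
def box (U : ℝ × R3 → ℝ) (p : ℝ × R3) : ℝ :=
  dirDeriv timeVec (dirDeriv timeVec U) p - ∑ i, dirDeriv (spaceVec i) (dirDeriv (spaceVec i) U) p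

theorem box_waveProp (hg : ContDiff ℝ ∞ g) (p : ℝ × R3) : box (waveProp g) p = 0 := by
  have hi : ∀ i, Continuous (dirDeriv (basisVec i) (dirDeriv (basisVec i) g)) :=
    fun i => (contDiff_dirDeriv (contDiff_dirDeriv hg _) _).continuous
  rw [box, dirDeriv_time_time_waveProp hg, laplacian_eq_sum hg]
  simp only [dirDeriv_space_waveProp hg, dirDeriv_space_waveProp (contDiff_dirDeriv hg _),
    waveProp, Fin.sum_univ_three]
  have h01 := sphericalMean_add ((hi 0).add (hi 1)) (hi 2) p
  simp only [Pi.add_apply] at h01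
  rw [h01]
  simp only [Pi.add_def]
  rw [sphericalMean_add (hi 0) (hi 1)]
  ring

theorem box_dirDeriv {U : ℝ × R3 → ℝ} (hU : ContDiff ℝ ∞ U) (v : ℝ × R3) (p : ℝ × R3) :
    box (dirDeriv v U) p = dirDeriv v (box U) p := by
  have h1 : ∀ w, dirDeriv w (dirDeriv w (dirDeriv v U)) = dirDeriv v (dirDeriv w (dirDeriv w U)) :=
    fun w => by rw [dirDeriv_comm hU w v, dirDeriv_comm (contDiff_dirDeriv hU w)]
  have h2 : ∀ w, ContDiff ℝ ∞ (dirDeriv w (dirDeriv w U)) :=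
    fun w => contDiff_dirDeriv (contDiff_dirDeriv hU _) _
  have h3 : box U = fun p => dirDeriv timeVec (dirDeriv timeVec U) p +
      -∑ i, dirDeriv (spaceVec i) (dirDeriv (spaceVec i) U) p := by
    ext p; simp [box, sub_eq_add_neg]
  rw [h3, dirDeriv_add (h2 _) (ContDiff.sum fun i _ => h2 _).neg, dirDeriv_neg,
    dirDeriv_sum _ fun i => h2 _]
  simp [box, h1, sub_eq_add_neg]

theorem box_add {U V : ℝ × R3 → ℝ} (hU : ContDiff ℝ ∞ U) (hV : ContDiff ℝ ∞ V) (p : ℝ × R3) :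
    box (fun p => U p + V p) p = box U p + box V p := by
  have h : ∀ w, dirDeriv w (dirDeriv w fun p => U p + V p) =
      fun p => dirDeriv w (dirDeriv w U) p + dirDeriv w (dirDeriv w V) p := fun w => by
    rw [dirDeriv_add hU hV, dirDeriv_add (contDiff_dirDeriv hU w) (contDiff_dirDeriv hV w)]
  simp only [box, h, Finset.sum_add_distrib]
  ring

/-- Kirchhoff's solution `∂_t (t M_t v₀) + t M_t v₁` of the free wave equation with data
`(v₀, v₁)`. -/
def freeWave (v₀ v₁ : R3 → ℝ) (p : ℝ × R3) : ℝ :=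
  dirDeriv timeVec (waveProp v₀) p + waveProp v₁ p

variable {v₀ v₁ : R3 → ℝ}

theorem contDiff_freeWave (h₀ : ContDiff ℝ ∞ v₀) (h₁ : ContDiff ℝ ∞ v₁) :
    ContDiff ℝ ∞ (freeWave v₀ v₁) :=
  (contDiff_dirDeriv (contDiff_waveProp h₀) _).add (contDiff_waveProp h₁)

theorem box_freeWave (h₀ : ContDiff ℝ ∞ v₀) (h₁ : ContDiff ℝ ∞ v₁) (p : ℝ × R3) :
    box (freeWave v₀ v₁) p = 0 := by
  refine (box_add (contDiff_dirDeriv (contDiff_waveProp h₀) _) (contDiff_waveProp h₁) p).trans ?_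
  have : box (waveProp v₀) = fun _ => 0 := funext (box_waveProp h₀)
  rw [box_dirDeriv (contDiff_waveProp h₀), box_waveProp h₁, this]
  simp [dirDeriv]

theorem sphericalMean_zero_time (g : R3 → ℝ) (x : R3) : sphericalMean g (0, x) = g x := by
  simp [sphericalMean]

theorem freeWave_zero_time (h₀ : ContDiff ℝ ∞ v₀) (x : R3) : freeWave v₀ v₁ (0, x) = v₀ x := by
  simp [freeWave, dirDeriv_time_waveProp h₀, waveProp, sphericalMean_zero_time]

theorem dirDeriv_time_freeWave (h₀ : ContDiff ℝ ∞ v₀) (h₁ : ContDiff ℝ ∞ v₁) :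
    dirDeriv timeVec (freeWave v₀ v₁) = fun p =>
      waveProp (Laplacian.laplacian v₀) p + dirDeriv timeVec (waveProp v₁) p := by
  refine (dirDeriv_add (contDiff_dirDeriv (contDiff_waveProp h₀) _)
    (contDiff_waveProp h₁) _).trans ?_
  rw [dirDeriv_time_time_waveProp h₀]

theorem dirDeriv_time_freeWave_zero_time (h₀ : ContDiff ℝ ∞ v₀) (h₁ : ContDiff ℝ ∞ v₁) (x : R3) :
    dirDeriv timeVec (freeWave v₀ v₁) (0, x) = v₁ x := by
  simp [dirDeriv_time_freeWave h₀ h₁, dirDeriv_time_waveProp h₁, waveProp, sphericalMean_zero_time]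

theorem sphericalMean_neg_time (hg : Continuous g) (t : ℝ) (x : R3) :
    sphericalMean g (-t, x) = sphericalMean g (t, x) := by
  have := integral_sphere_comp_isometry (LinearIsometryEquiv.neg ℝ) (k := fun y => g (x + t • y))
    (by fun_prop)
  simpa [sphericalMean] using this

theorem normalMean_neg_time (hg : ContDiff ℝ ∞ g) (t : ℝ) (x : R3) :
    normalMean g (-t, x) = -normalMean g (t, x) := by
  have hc : Continuous (fderiv ℝ g) := hg.continuous_fderiv (by simp)
  have := integral_sphere_comp_isometry (LinearIsometryEquiv.neg ℝ)
    (k := fun y => fderiv ℝ g (x + t • y) y) (by fun_prop)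
  simp only [LinearIsometryEquiv.coe_neg, smul_neg, map_neg, integral_neg] at this
  simp [normalMean, ← this]

end SphericalMean

/-! ### Lower bounds for free waves -/

section Positivity

variable {v₀ v₁ g : R3 → ℝ}

theorem freeWave_eq (h₀ : ContDiff ℝ ∞ v₀) (p : ℝ × R3) :
    freeWave v₀ v₁ p = sphericalMean v₀ p + p.1 * normalMean v₀ p + p.1 * sphericalMean v₁ p := by
  simp [freeWave, dirDeriv_time_waveProp h₀, waveProp]

theorem integrable_mean (hg : Continuous g) (p : ℝ × R3) :
    Integrable (fun θ : S2 => g (p.2 + p.1 • (θ : R3))) sphereProb :=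
  integrable_sphere (k := fun y => g (p.2 + p.1 • y)) (by fun_prop)

theorem integrable_normal (hg : ContDiff ℝ ∞ g) (p : ℝ × R3) :
    Integrable (fun θ : S2 => fderiv ℝ g (p.2 + p.1 • (θ : R3)) θ) sphereProb := by
  have hc : Continuous (fderiv ℝ g) := hg.continuous_fderiv (by simp)
  exact integrable_sphere (k := fun y => fderiv ℝ g (p.2 + p.1 • y) y) (by fun_prop)

theorem abs_fderiv_sphere_le (g : R3 → ℝ) (y : R3) (θ : S2) :
    |fderiv ℝ g y θ| ≤ ‖fderiv ℝ g y‖ := by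
  simpa using (fderiv ℝ g y).le_opNorm θ

theorem le_sphericalMean {m : ℝ} (hg : Continuous g) (hm : ∀ x, m ≤ g x) (p : ℝ × R3) :
    m ≤ sphericalMean g p := by
  have := integral_mono (integrable_const m) (integrable_mean hg p) (fun θ => hm _)
  simpa [sphericalMean] using this

/-- The forward lower bound: for `t ≥ 0` the wave is the mean over a sphere of
`v₀ + t (∂_ν v₀ + v₁)`, and the second summand is nonnegative. -/
theorem le_freeWave_of_gradient_le {m : ℝ} (h₀ : ContDiff ℝ ∞ v₀) (h₁ : ContDiff ℝ ∞ v₁)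
    (hm : ∀ x, m ≤ v₀ x) (hv : ∀ x, ‖fderiv ℝ v₀ x‖ ≤ v₁ x) {t : ℝ} (ht : 0 ≤ t) (x : R3) :
    m ≤ freeWave v₀ v₁ (t, x) := by
  have h1 := le_sphericalMean h₀.continuous hm (t, x)
  have h2 : 0 ≤ normalMean v₀ (t, x) + sphericalMean v₁ (t, x) := by
    rw [normalMean, sphericalMean,
      ← integral_add (integrable_normal h₀ (t, x)) (integrable_mean h₁.continuous (t, x))]
    refine integral_nonneg fun θ => ?_
    have h3 := neg_le_of_abs_le (abs_fderiv_sphere_le v₀ (x + t • (θ : R3)) θ)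
    have h4 := hv (x + t • (θ : R3))
    change 0 ≤ fderiv ℝ v₀ (x + t • (θ : R3)) θ + v₁ (x + t • (θ : R3))
    linarith
  rw [freeWave_eq h₀]
  nlinarith [mul_nonneg ht h2]

theorem tendsto_translate_cocompact (x : R3) (θ : S2) :
    Tendsto (fun T : ℝ => x + T • (θ : R3)) atTop (cocompact R3) := by
  rw [← Metric.cobounded_eq_cocompact, ← tendsto_norm_atTop_iff_cobounded]
  refine tendsto_atTop_mono' atTop ?_ (tendsto_atTop_add_const_right atTop (-‖x‖) tendsto_id)
  filter_upwards [eventually_ge_atTop 0] with T hT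
  have := norm_sub_le (x + T • (θ : R3)) x
  rw [add_sub_cancel_left, norm_smul, norm_sphere, Real.norm_of_nonneg hT] at this
  simp only [id]
  linarith

theorem exists_bound_of_tendsto_cocompact (hg : Continuous g)
    (h : Tendsto g (cocompact R3) (𝓝 0)) : ∃ C, 0 ≤ C ∧ ∀ x, |g x| ≤ C := by
  have h1 : ∀ᶠ x in cocompact R3, |g x| ≤ 1 := by
    filter_upwards [h.eventually (Metric.ball_mem_nhds 0 one_pos)] with x hx
    simpa using (mem_ball_zero_iff.1 hx).le
  obtain ⟨K, hK, hK'⟩ := mem_cocompact.1 h1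
  obtain ⟨C, hC⟩ := hK.exists_bound_of_continuousOn hg.continuousOn
  refine ⟨max 1 C, by positivity, fun x => ?_⟩
  by_cases hx : x ∈ K
  · exact (hC x hx).trans (le_max_right _ _)
  · exact (hK' hx : |g x| ≤ 1).trans (le_max_left _ _)

theorem tendsto_sphericalMean (hg : Continuous g) (h : Tendsto g (cocompact R3) (𝓝 0)) (x : R3) :
    Tendsto (fun T : ℝ => sphericalMean g (T, x)) atTop (𝓝 0) := by
  obtain ⟨C, -, hC⟩ := exists_bound_of_tendsto_cocompact hg h
  have := tendsto_integral_filter_of_dominated_convergence (μ := sphereProb) (l := atTop)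
    (F := fun (T : ℝ) (θ : S2) => g (x + T • (θ : R3))) (f := fun _ => 0) (fun _ => C)
    (Eventually.of_forall fun T => (integrable_mean hg (T, x)).aestronglyMeasurable)
    (Eventually.of_forall fun T => Eventually.of_forall fun θ => hC _) (integrable_const C)
    (Eventually.of_forall fun θ => h.comp (tendsto_translate_cocompact x θ))
  simpa [sphericalMean] using this

theorem hasDerivAt_time {U : ℝ × R3 → ℝ} {t : ℝ} {x : R3} (hU : DifferentiableAt ℝ U (t, x)) :
    HasDerivAt (fun s => U (s, x)) (dirDeriv timeVec U (t, x)) t :=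
  hU.hasFDerivAt.comp_hasDerivAt t ((hasDerivAt_id t).prodMk (hasDerivAt_const t x))

theorem sphericalMean_nonpos (hg : ∀ x, g x ≤ 0) (p : ℝ × R3) : sphericalMean g p ≤ 0 :=
  integral_nonpos fun _ => hg _

/-- If `Δv₀ ≤ 0` and `v₀ → 0` at infinity, then `t ↦ t M_t v₀(x)` is concave on `[0, ∞)` and grows
slower than linearly, so it is nondecreasing. -/
theorem dirDeriv_time_waveProp_nonneg (h₀ : ContDiff ℝ ∞ v₀)
    (hl : ∀ x, Laplacian.laplacian v₀ x ≤ 0) (hd : Tendsto v₀ (cocompact R3) (𝓝 0))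
    {t : ℝ} (ht : 0 ≤ t) (x : R3) : 0 ≤ dirDeriv timeVec (waveProp v₀) (t, x) := by
  set φ : ℝ → ℝ := fun s => waveProp v₀ (s, x) with hφ
  set φ' : ℝ → ℝ := fun s => dirDeriv timeVec (waveProp v₀) (s, x) with hφ'
  have hs := contDiff_waveProp h₀
  have d1 : ∀ s, HasDerivAt φ (φ' s) s := fun s => hasDerivAt_time (hs.differentiable (by simp) _)
  have d2 : ∀ s, HasDerivAt φ' (waveProp (Laplacian.laplacian v₀) (s, x)) s := fun s => by
    rw [← dirDeriv_time_time_waveProp h₀]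
    exact hasDerivAt_time ((contDiff_dirDeriv hs _).differentiable (by simp) _)
  have anti : AntitoneOn φ' (Ici 0) := by
    refine antitoneOn_of_deriv_nonpos (convex_Ici 0)
      (fun s _ => (d2 s).continuousAt.continuousWithinAt)
      (fun s _ => (d2 s).differentiableAt.differentiableWithinAt) fun s hs => ?_
    rw [(d2 s).deriv]
    rw [interior_Ici, mem_Ioi] at hs
    exact mul_nonpos_of_nonneg_of_nonpos hs.le (sphericalMean_nonpos hl _)
  -- the concave function `φ` lies below its tangent at `t`; divide by `s` and let `s → ∞`
  have hle : ∀ᶠ s in atTop, sphericalMean v₀ (s, x) ≤ (φ t - φ' t * t) / s + φ' t := by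
    filter_upwards [eventually_gt_atTop t] with s hts
    have hs0 : 0 < s := ht.trans_lt hts
    obtain ⟨c, hc, hc'⟩ := exists_hasDerivAt_eq_slope φ φ' hts
      (fun s _ => (d1 s).continuousAt.continuousWithinAt) fun s _ => d1 s
    have h1 : φ' c ≤ φ' t := anti ht (ht.trans hc.1.le) hc.1.le
    rw [hc', div_le_iff₀ (sub_pos.2 hts)] at h1
    have h2 : φ s = s * sphericalMean v₀ (s, x) := rfl
    rw [div_add' _ _ _ hs0.ne', le_div_iff₀ hs0]
    linarith
  have hlim : Tendsto (fun s : ℝ => (φ t - φ' t * t) / s + φ' t) atTop (𝓝 (φ' t)) := by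
    simpa using (tendsto_const_nhds.div_atTop tendsto_id).add_const (φ' t)
  exact le_of_tendsto_of_tendsto (tendsto_sphericalMean h₀.continuous hd x) hlim hle

/-- For fixed `t ≥ 0` and `|c| ≤ t` the function `∂_s (s M_s v₀) + c M_s v₁` of `s ≥ t` is
nonincreasing, and bounded below by `c M_s v₁`, which tends to zero. -/
theorem dirDeriv_time_waveProp_add_nonneg (h₀ : ContDiff ℝ ∞ v₀) (h₁ : ContDiff ℝ ∞ v₁)
    (hl : ∀ x, ‖fderiv ℝ v₁ x‖ ≤ -Laplacian.laplacian v₀ x)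
    (hd₀ : Tendsto v₀ (cocompact R3) (𝓝 0)) (hd₁ : Tendsto v₁ (cocompact R3) (𝓝 0))
    {t c : ℝ} (hc : |c| ≤ t) (x : R3) :
    0 ≤ dirDeriv timeVec (waveProp v₀) (t, x) + c * sphericalMean v₁ (t, x) := by
  have ht : 0 ≤ t := (abs_nonneg c).trans hc
  have hl0 : ∀ x, Laplacian.laplacian v₀ x ≤ 0 := fun x => by
    linarith [hl x, norm_nonneg (fderiv ℝ v₁ x)]
  set G : ℝ → ℝ := fun s => dirDeriv timeVec (waveProp v₀) (s, x) + c * sphericalMean v₁ (s, x)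
  have hs := contDiff_waveProp h₀
  have dG : ∀ s, HasDerivAt G
      (waveProp (Laplacian.laplacian v₀) (s, x) + c * normalMean v₁ (s, x)) s := fun s => by
    rw [← dirDeriv_time_time_waveProp h₀, ← dirDeriv_time_sphericalMean h₁]
    exact (hasDerivAt_time ((contDiff_dirDeriv hs _).differentiable (by simp) _)).add
      ((hasDerivAt_time ((contDiff_sphericalMean h₁).differentiable (by simp) _)).const_mul c)
  have anti : AntitoneOn G (Ici t) := by
    refine antitoneOn_of_deriv_nonpos (convex_Ici t)
      (fun s _ => (dG s).continuousAt.continuousWithinAt)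
      (fun s _ => (dG s).differentiableAt.differentiableWithinAt) fun s hs => ?_
    rw [(dG s).deriv]
    rw [interior_Ici, mem_Ioi] at hs
    rw [waveProp, sphericalMean, normalMean, ← integral_const_mul, ← integral_const_mul,
      ← integral_add ((integrable_mean (contDiff_laplacian h₀).continuous (s, x)).const_mul s)
        ((integrable_normal h₁ (s, x)).const_mul c)]
    refine integral_nonpos fun θ => ?_
    change s * Laplacian.laplacian v₀ (x + s • (θ : R3)) + c * fderiv ℝ v₁ (x + s • (θ : R3)) θ ≤ 0
    set y := x + s • (θ : R3)
    have h1 : c * fderiv ℝ v₁ y θ ≤ s * -Laplacian.laplacian v₀ y :=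
      calc c * fderiv ℝ v₁ y θ ≤ |c| * |fderiv ℝ v₁ y θ| := by
            rw [← abs_mul]; exact le_abs_self _
        _ ≤ s * -Laplacian.laplacian v₀ y := by
            gcongr
            · exact ht.trans hs.le
            · exact hc.trans hs.le
            · exact (abs_fderiv_sphere_le v₁ y θ).trans (hl y)
    linarith
  have hlim : Tendsto (fun s : ℝ => c * sphericalMean v₁ (s, x)) atTop (𝓝 0) := by
    simpa using (tendsto_sphericalMean h₁.continuous hd₁ x).const_mul c
  refine le_of_tendsto hlim ?_
  filter_upwards [eventually_ge_atTop t] with s hts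
  have h1 : G s ≤ G t := anti self_mem_Ici hts hts
  have h2 := dirDeriv_time_waveProp_nonneg h₀ hl0 hd₀ (ht.trans hts) x
  change _ ≤ G t
  change dirDeriv timeVec (waveProp v₀) (s, x) + c * sphericalMean v₁ (s, x) ≤ _ at h1
  linarith

theorem dirDeriv_time_waveProp_neg_time (h₀ : ContDiff ℝ ∞ v₀) (t : ℝ) (x : R3) :
    dirDeriv timeVec (waveProp v₀) (-t, x) = dirDeriv timeVec (waveProp v₀) (t, x) := by
  simp [dirDeriv_time_waveProp h₀, sphericalMean_neg_time h₀.continuous, normalMean_neg_time h₀]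

/-- Under time reversal `∂_t (t M_t v₀)` is even and `t M_t v₁` is odd, so negative times correspond
to the coefficient `c = t` at the time `-t`. -/
theorem freeWave_nonneg_of_laplacian (h₀ : ContDiff ℝ ∞ v₀) (h₁ : ContDiff ℝ ∞ v₁)
    (hl : ∀ x, ‖fderiv ℝ v₁ x‖ ≤ -Laplacian.laplacian v₀ x)
    (hd₀ : Tendsto v₀ (cocompact R3) (𝓝 0)) (hd₁ : Tendsto v₁ (cocompact R3) (𝓝 0))
    (t : ℝ) (x : R3) : 0 ≤ freeWave v₀ v₁ (t, x) := by
  rcases le_total 0 t with ht | ht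
  · simpa [freeWave, waveProp, abs_of_nonneg ht] using
      dirDeriv_time_waveProp_add_nonneg h₀ h₁ hl hd₀ hd₁ (abs_of_nonneg ht).le x
  · have := dirDeriv_time_waveProp_add_nonneg h₀ h₁ hl hd₀ hd₁ (abs_of_nonpos ht).le x
    rwa [dirDeriv_time_waveProp_neg_time h₀, sphericalMean_neg_time h₁.continuous] at this

end Positivity

/-! ### Boundedness of free waves with Lorentz data -/

section Bounded

/-- Integration in polar coordinates, with the unnormalised surface measure. -/
theorem lintegral_polar {f : R3 → ℝ≥0∞} (hf : Measurable f) :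
    ∫⁻ y, f y = ∫⁻ θ : S2, (∫⁻ r in Ioi (0 : ℝ), ENNReal.ofReal (r ^ 2) * f (r • (θ : R3)))
      ∂(volume : Measure R3).toSphere := by
  have hmp := (volume : Measure R3).measurePreserving_homeomorphUnitSphereProd
  have h1 : ∫⁻ y, f y = ∫⁻ y : ({0}ᶜ : Set R3), f y ∂(Measure.comap Subtype.val volume) := by
    rw [lintegral_subtype_comap (measurableSet_singleton _).compl, restrict_compl_singleton]
  have h2 := hmp.lintegral_comp_emb (Homeomorph.measurableEmbedding _)
    (fun z => f ((homeomorphUnitSphereProd R3).symm z))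
  simp only [Homeomorph.symm_apply_apply] at h2
  have hm : Measurable fun z : S2 × Ioi (0 : ℝ) => f ((homeomorphUnitSphereProd R3).symm z) :=
    hf.comp (measurable_subtype_coe.comp (homeomorphUnitSphereProd R3).symm.measurable)
  rw [h1, h2, lintegral_prod _ hm.aemeasurable]
  refine lintegral_congr fun θ => ?_
  simp only [homeomorphUnitSphereProd_symm_apply_coe, finrank_euclideanSpace, Fintype.card_fin]
  have hm' : Measurable fun r : Ioi (0 : ℝ) => f ((r : ℝ) • (θ : R3)) :=
    hf.comp (by fun_prop)
  rw [Measure.volumeIoiPow, lintegral_withDensity_eq_lintegral_mul _ (by fun_prop) hm']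
  exact lintegral_subtype_comap measurableSet_Ioi
    fun r : ℝ => ENNReal.ofReal (r ^ 2) * f (r • (θ : R3))

/-- A function vanishing at infinity is controlled by its derivative along an outward ray. -/
theorem enorm_sphere_point_le {E : Type*} [NormedAddCommGroup E] [NormedSpace ℝ E]
    [CompleteSpace E] {h : R3 → E} (hh : ContDiff ℝ 1 h)
    (h0 : Tendsto h (cocompact R3) (𝓝 0)) (t : ℝ) (x : R3) (θ : S2) :
    ‖h (x + t • (θ : R3))‖ₑ ≤ ∫⁻ r in Ioi t, ‖fderiv ℝ h (x + r • (θ : R3))‖ₑ := by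
  have hd : Continuous (fderiv ℝ h) := hh.continuous_fderiv one_ne_zero
  have hline : ∀ r, HasDerivAt (fun r : ℝ => h (x + r • (θ : R3)))
      (fderiv ℝ h (x + r • (θ : R3)) θ) r := fun r => by
    have h1 : HasDerivAt (fun r : ℝ => x + r • (θ : R3)) (θ : R3) r := by
      simpa using ((hasDerivAt_id r).smul_const (θ : R3)).const_add x
    exact (hh.differentiable one_ne_zero _).hasFDerivAt.comp_hasDerivAt r h1
  set I := ∫⁻ r in Ioi t, ‖fderiv ℝ h (x + r • (θ : R3))‖ₑ
  have hle : ∀ᶠ T : ℝ in atTop, ‖h (x + t • (θ : R3))‖ₑ ≤ ‖h (x + T • (θ : R3))‖ₑ + I := by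
    filter_upwards [eventually_ge_atTop t] with T hT
    have hftc := intervalIntegral.integral_eq_sub_of_hasDerivAt (a := t) (b := T)
      (fun r _ => hline r) (Continuous.intervalIntegrable (by fun_prop) _ _)
    have h1 : h (x + t • (θ : R3)) =
        h (x + T • (θ : R3)) - ∫ r in t..T, fderiv ℝ h (x + r • (θ : R3)) θ := by
      rw [hftc]; abel
    rw [h1]
    refine enorm_sub_le.trans (add_le_add le_rfl ?_)
    rw [intervalIntegral.integral_of_le hT]
    refine (enorm_integral_le_lintegral_enorm _).trans ?_
    refine (lintegral_mono_set Ioc_subset_Ioi_self).trans (lintegral_mono fun r => ?_)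
    refine (ContinuousLinearMap.le_opENorm _ _).trans ?_
    simp [← ofReal_norm]
  have hlim : Tendsto (fun T : ℝ => ‖h (x + T • (θ : R3))‖ₑ + I) atTop (𝓝 (0 + I)) := by
    refine Tendsto.add ?_ tendsto_const_nhds
    simpa using (h0.comp (tendsto_translate_cocompact x θ)).enorm
  simpa using ge_of_tendsto hlim hle

/-- `t` times the integral of `‖h‖` over the sphere of radius `t` is at most the Newtonian
potential of `‖Dh‖`: write `h` as the integral of its radial derivative over the outward ray, and
use `t ≤ r` on that ray. -/
theorem lintegral_sphere_le_potential {E : Type*} [NormedAddCommGroup E] [NormedSpace ℝ E]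
    [CompleteSpace E] {h : R3 → E} (hh : ContDiff ℝ 1 h)
    (h0 : Tendsto h (cocompact R3) (𝓝 0)) {t : ℝ} (ht : 0 ≤ t) (x : R3) :
    ∫⁻ θ : S2, ENNReal.ofReal t * ‖h (x + t • (θ : R3))‖ₑ ∂(volume : Measure R3).toSphere ≤
      ∫⁻ y, ENNReal.ofReal ‖y - x‖⁻¹ * ‖fderiv ℝ h y‖ₑ := by
  have hd : Continuous (fderiv ℝ h) := hh.continuous_fderiv one_ne_zero
  have hshift : ∫⁻ y, ENNReal.ofReal ‖y - x‖⁻¹ * ‖fderiv ℝ h y‖ₑ =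
      ∫⁻ y, ENNReal.ofReal ‖y‖⁻¹ * ‖fderiv ℝ h (x + y)‖ₑ := by
    rw [← lintegral_add_left_eq_self _ x]
    simp
  rw [hshift, lintegral_polar]
  · refine lintegral_mono fun θ => ?_
    refine (mul_le_mul_right (enorm_sphere_point_le hh h0 t x θ) _).trans ?_
    rw [← lintegral_const_mul' _ _ ENNReal.ofReal_ne_top]
    refine (setLIntegral_mono' measurableSet_Ioi fun r hr => ?_).trans
      (lintegral_mono_set (Ioi_subset_Ioi ht))
    have hr0 : 0 < r := ht.trans_lt hr
    rw [← mul_assoc, ← ENNReal.ofReal_mul (by positivity), norm_smul, norm_sphere,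
      Real.norm_of_nonneg hr0.le]
    refine mul_le_mul_left (ENNReal.ofReal_le_ofReal ?_) _
    rw [mul_one, pow_two, mul_assoc, mul_inv_cancel₀ hr0.ne', mul_one]
    exact (mem_Ioi.1 hr).le
  · have : Measurable fun y => ‖fderiv ℝ h (x + y)‖ₑ := Continuous.measurable (by fun_prop)
    fun_prop

theorem lintegral_ball_inv_norm_le (x : R3) {R : ℝ} (hR : 0 ≤ R) :
    ∫⁻ y in Metric.ball x R, ENNReal.ofReal ‖y - x‖⁻¹ ≤
      (volume : Measure R3).toSphere univ * ENNReal.ofReal (R ^ 2) := by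
  have h1 : ∫⁻ y in Metric.ball x R, ENNReal.ofReal ‖y - x‖⁻¹ =
      ∫⁻ y, (Metric.ball (0 : R3) R).indicator (fun y => ENNReal.ofReal ‖y‖⁻¹) y := by
    rw [← lintegral_indicator Metric.isOpen_ball.measurableSet, ← lintegral_add_left_eq_self _ x]
    refine lintegral_congr fun y => ?_
    simp [indicator, dist_eq_norm]
  rw [h1, lintegral_polar ((by fun_prop : Measurable fun y : R3 => ENNReal.ofReal ‖y‖⁻¹).indicator
    Metric.isOpen_ball.measurableSet)]
  have h2 : ∀ θ : S2, ∫⁻ r in Ioi (0 : ℝ), ENNReal.ofReal (r ^ 2) *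
      (Metric.ball (0 : R3) R).indicator (fun y => ENNReal.ofReal ‖y‖⁻¹) (r • (θ : R3)) ≤
      ENNReal.ofReal (R ^ 2) := by
    intro θ
    calc _ ≤ ∫⁻ r in Ioi (0 : ℝ), (Iio R).indicator (fun _ => ENNReal.ofReal R) r := by
          refine setLIntegral_mono' measurableSet_Ioi fun r hr => ?_
          have hr0 : 0 < r := hr
          have hn : ‖r • (θ : R3)‖ = r := by
            rw [norm_smul, norm_sphere, Real.norm_of_nonneg hr0.le, mul_one]
          by_cases hrR : r < R
          · rw [indicator_of_mem (by simpa [hn] using hrR), indicator_of_mem (mem_Iio.2 hrR), hn,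
              ← ENNReal.ofReal_mul (by positivity)]
            refine ENNReal.ofReal_le_ofReal ?_
            rw [pow_two, mul_assoc, mul_inv_cancel₀ hr0.ne', mul_one]
            exact hrR.le
          · rw [indicator_of_notMem (by simpa [hn] using hrR)]
            simp
      _ = ENNReal.ofReal (R ^ 2) := by
          rw [lintegral_indicator measurableSet_Iio, setLIntegral_const,
            Measure.restrict_apply measurableSet_Iio, Iio_inter_Ioi, Real.volume_Ioo, sub_zero,
            ← ENNReal.ofReal_mul hR, pow_two]
  refine (lintegral_mono h2).trans ?_
  rw [lintegral_const, mul_comm]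

/-- The Newtonian potential of a set is controlled by the power `2/3` of its volume, i.e. `1/|y|`
belongs to weak `L³`. The set is split at the radius of a ball of comparable volume. -/
theorem lintegral_inv_norm_le (x : R3) {s : Set R3} (hs : MeasurableSet s) :
    ∫⁻ y in s, ENNReal.ofReal ‖y - x‖⁻¹ ≤
      ((volume : Measure R3).toSphere univ + 1) * volume s ^ (2 / 3 : ℝ) := by
  rcases eq_or_ne (volume s) ⊤ with htop | htop
  · rw [htop, ENNReal.top_rpow_of_pos (by norm_num), ENNReal.mul_top (by simp)]
    exact le_top
  rcases eq_or_ne (volume s) 0 with h0 | h0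
  · rw [setLIntegral_measure_zero _ _ h0]
    exact zero_le
  set m := (volume s).toReal
  have hm : 0 < m := ENNReal.toReal_pos h0 htop
  have hvm : volume s = ENNReal.ofReal m := (ENNReal.ofReal_toReal htop).symm
  set R := m ^ (1 / 3 : ℝ)
  have hR : 0 < R := Real.rpow_pos_of_pos hm _
  have hR2 : R ^ 2 = m ^ (2 / 3 : ℝ) := by
    rw [← Real.rpow_natCast, ← Real.rpow_mul hm.le]; norm_num
  have hR3 : R⁻¹ * m = m ^ (2 / 3 : ℝ) := by
    rw [← Real.rpow_neg hm.le, ← Real.rpow_add_one hm.ne']; norm_num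
  have hfar : ∫⁻ y in s \ Metric.ball x R, ENNReal.ofReal ‖y - x‖⁻¹ ≤
      ENNReal.ofReal (m ^ (2 / 3 : ℝ)) := by
    calc _ ≤ ∫⁻ y in s \ Metric.ball x R, ENNReal.ofReal R⁻¹ := by
          refine setLIntegral_mono' (hs.diff Metric.isOpen_ball.measurableSet) fun y hy => ?_
          refine ENNReal.ofReal_le_ofReal (inv_anti₀ hR ?_)
          simpa [dist_eq_norm] using hy.2
      _ ≤ ENNReal.ofReal R⁻¹ * volume s := by
          rw [setLIntegral_const]
          exact mul_le_mul_right (measure_mono sdiff_subset) _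
      _ = _ := by rw [hvm, ← ENNReal.ofReal_mul (by positivity), hR3]
  calc ∫⁻ y in s, ENNReal.ofReal ‖y - x‖⁻¹
      ≤ ∫⁻ y in Metric.ball x R ∪ s \ Metric.ball x R, ENNReal.ofReal ‖y - x‖⁻¹ :=
        lintegral_mono_set (by simp)
    _ ≤ (volume : Measure R3).toSphere univ * ENNReal.ofReal (m ^ (2 / 3 : ℝ)) +
          ENNReal.ofReal (m ^ (2 / 3 : ℝ)) := by
        refine (lintegral_union_le _ _ _).trans (add_le_add ?_ hfar)
        rw [← hR2]
        exact lintegral_ball_inv_norm_le x hR.le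
    _ = _ := by
        rw [hvm, ENNReal.ofReal_rpow_of_pos hm]
        ring

/-- The Newtonian potential of `k` is bounded by the `L^{3/2,1}` norm of `k`, up to a constant: sum
the bound for sets over the superlevel sets of `k`. -/
theorem potential_le_lorentz (x : R3) {k : R3 → ℝ} (hk : Continuous k) (hk0 : ∀ y, 0 ≤ k y) :
    ∫⁻ y, ENNReal.ofReal ‖y - x‖⁻¹ * ENNReal.ofReal (k y) ≤
      ((volume : Measure R3).toSphere univ + 1) *
        ∫⁻ s in Ioi (0 : ℝ), volume {y | s < k y} ^ (2 / 3 : ℝ) := by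
  have hw : Measurable fun y : R3 => ENNReal.ofReal ‖y - x‖⁻¹ := by fun_prop
  have h1 := lintegral_eq_lintegral_meas_lt
    ((volume : Measure R3).withDensity fun y => ENNReal.ofReal ‖y - x‖⁻¹)
    (Eventually.of_forall hk0) hk.measurable.aemeasurable
  rw [lintegral_withDensity_eq_lintegral_mul _ hw (by fun_prop)] at h1
  refine h1.le.trans ?_
  rw [← lintegral_const_mul' _ _ (ENNReal.add_ne_top.2 ⟨measure_ne_top _ _, ENNReal.one_ne_top⟩)]
  refine lintegral_mono fun s => ?_
  have hs : MeasurableSet {y | s < k y} := measurableSet_lt measurable_const hk.measurable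
  rw [withDensity_apply _ hs]
  exact lintegral_inv_norm_le x hs

theorem lorentzNorm_three_halves_one {G : Type*} [NormedAddCommGroup G] (g : R3 → G) :
    lorentzNorm g (3 / 2) 1 volume = ENNReal.ofReal (3 / 2) *
      ∫⁻ s in Ioi (0 : ℝ), volume {y | s < ‖g y‖} ^ (2 / 3 : ℝ) := by
  simp only [lorentzNorm, div_one, ENNReal.rpow_one]
  congr 1
  refine setLIntegral_congr_fun measurableSet_Ioi fun s hs => ?_
  have hs' : 0 < s := hs
  beta_reduce
  rw [mul_comm (ENNReal.ofReal s), mul_assoc, ← ENNReal.ofReal_mul hs'.le,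
    mul_inv_cancel₀ hs'.ne']
  norm_num

/-- If `h` vanishes at infinity and `Dh` lies in `L^{3/2,1}`, then `|t| M_t ‖h‖` is bounded
uniformly in time and space. -/
theorem exists_bound_sphericalMean_norm {E G : Type*} [NormedAddCommGroup E] [NormedSpace ℝ E]
    [CompleteSpace E] [NormedAddCommGroup G] {h : R3 → E} (hh : ContDiff ℝ 1 h)
    (h0 : Tendsto h (cocompact R3) (𝓝 0)) {k : R3 → G} (hk : ∀ y, ‖k y‖ = ‖fderiv ℝ h y‖)
    (hL : MemLorentz k (3 / 2) 1 volume) :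
    ∃ C, ∀ t x, |t| * sphericalMean (fun y => ‖h y‖) (t, x) ≤ C := by
  set τ := (volume : Measure R3).toSphere
  set J := ∫⁻ s in Ioi (0 : ℝ), volume {y | s < ‖k y‖} ^ (2 / 3 : ℝ) with hJdef
  have hJ : J < ⊤ := by
    have := hL.2
    rw [lorentzNorm_three_halves_one] at this
    exact (ENNReal.mul_lt_top_iff.1 this).elim (fun h => h.2) fun h => by
      rcases h with h | h
      · norm_num at h
      · rw [hJdef, h]; exact ENNReal.zero_lt_top
  have hτ : (τ univ)⁻¹ ≠ ⊤ :=
    ENNReal.inv_ne_top.2 fun h => NeZero.ne τ (Measure.measure_univ_eq_zero.1 h)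
  have hB : (τ univ)⁻¹ * ((τ univ + 1) * J) ≠ ⊤ :=
    ENNReal.mul_ne_top hτ (ENNReal.mul_ne_top
      (ENNReal.add_ne_top.2 ⟨measure_ne_top _ _, ENNReal.one_ne_top⟩) hJ.ne)
  have hc : Continuous fun y => ‖h y‖ := hh.continuous.norm
  have pos : ∀ t, 0 ≤ t → ∀ x, t * sphericalMean (fun y => ‖h y‖) (t, x) ≤
      ((τ univ)⁻¹ * ((τ univ + 1) * J)).toReal := by
    intro t ht x
    have h1 : ENNReal.ofReal (t * sphericalMean (fun y => ‖h y‖) (t, x)) ≤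
        (τ univ)⁻¹ * ((τ univ + 1) * J) := by
      rw [sphericalMean, ← integral_const_mul, ofReal_integral_eq_lintegral_ofReal
        ((integrable_mean hc (t, x)).const_mul t) (Eventually.of_forall fun θ => by
          simp only [Pi.zero_apply]; positivity), sphereProb, lintegral_smul_measure, smul_eq_mul]
      refine mul_le_mul_right ?_ _
      have h2 := (lintegral_sphere_le_potential hh h0 ht x).trans (by
        simpa only [ofReal_norm] using
          potential_le_lorentz x (hh.continuous_fderiv one_ne_zero).norm fun y => norm_nonneg _)
      simp only [hJdef, hk]
      refine le_trans (le_of_eq ?_) h2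
      refine lintegral_congr fun θ => ?_
      rw [ENNReal.ofReal_mul ht, ofReal_norm]
    exact (ENNReal.ofReal_le_iff_le_toReal hB).1 h1
  refine ⟨((τ univ)⁻¹ * ((τ univ + 1) * J)).toReal, fun t x => ?_⟩
  rcases abs_cases t with ⟨h1, h2⟩ | ⟨h1, h2⟩
  · rw [h1]; exact pos t h2 x
  · rw [h1, ← sphericalMean_neg_time hc]; exact pos (-t) (by linarith) x

/-- A free wave is bounded if `v₀` is bounded and `|Dv₀| ≤ A |h₀|`, `|v₁| ≤ A |h₁|` with `h₀`, `h₁`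
such that `|t| M_t |h₀|` and `|t| M_t |h₁|` are bounded. -/
theorem exists_bound_freeWave {E₀ E₁ : Type*} [NormedAddCommGroup E₀] [NormedAddCommGroup E₁]
    {v₀ v₁ : R3 → ℝ} (hv₀ : ContDiff ℝ ∞ v₀)
    {h₀ : R3 → E₀} {h₁ : R3 → E₁} (hc₀ : Continuous h₀) (hc₁ : Continuous h₁)
    {A B C₀ C₁ : ℝ} (hA : 0 ≤ A) (hB : ∀ y, |v₀ y| ≤ B) (hd : ∀ y, ‖fderiv ℝ v₀ y‖ ≤ A * ‖h₀ y‖)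
    (h1 : ∀ y, |v₁ y| ≤ A * ‖h₁ y‖)
    (hC₀ : ∀ t x, |t| * sphericalMean (fun y => ‖h₀ y‖) (t, x) ≤ C₀)
    (hC₁ : ∀ t x, |t| * sphericalMean (fun y => ‖h₁ y‖) (t, x) ≤ C₁) :
    ∃ C, ∀ p, |freeWave v₀ v₁ p| ≤ C := by
  refine ⟨B + A * C₀ + A * C₁, fun p => ?_⟩
  have e0 : |sphericalMean v₀ p| ≤ B := by
    have := norm_integral_le_of_norm_le (μ := sphereProb)
      (f := fun θ : S2 => v₀ (p.2 + p.1 • (θ : R3))) (integrable_const B)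
      (Eventually.of_forall fun θ => hB _)
    simpa [sphericalMean] using this
  have e1 : |normalMean v₀ p| ≤ A * sphericalMean (fun y => ‖h₀ y‖) p := by
    rw [sphericalMean, ← integral_const_mul]
    exact norm_integral_le_of_norm_le (f := fun θ : S2 => fderiv ℝ v₀ (p.2 + p.1 • (θ : R3)) θ)
      ((integrable_mean hc₀.norm p).const_mul A)
      (Eventually.of_forall fun θ => (abs_fderiv_sphere_le _ _ _).trans (hd _))
  have e2 : |sphericalMean v₁ p| ≤ A * sphericalMean (fun y => ‖h₁ y‖) p := by
    rw [sphericalMean, sphericalMean, ← integral_const_mul]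
    exact norm_integral_le_of_norm_le (f := fun θ : S2 => v₁ (p.2 + p.1 • (θ : R3)))
      ((integrable_mean hc₁.norm p).const_mul A)
      (Eventually.of_forall fun θ => h1 _)
  have f1 : |p.1 * normalMean v₀ p| ≤ A * C₀ := by
    rw [abs_mul]
    nlinarith [mul_le_mul_of_nonneg_left e1 (abs_nonneg p.1),
      mul_le_mul_of_nonneg_left (hC₀ p.1 p.2) hA]
  have f2 : |p.1 * sphericalMean v₁ p| ≤ A * C₁ := by
    rw [abs_mul]
    nlinarith [mul_le_mul_of_nonneg_left e2 (abs_nonneg p.1),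
      mul_le_mul_of_nonneg_left (hC₁ p.1 p.2) hA]
  rw [freeWave_eq hv₀]
  exact (abs_add_le _ _).trans (add_le_add ((abs_add_le _ _).trans (add_le_add e0 f1)) f2)

end Bounded

/-! ### The substitution `v = F(u)` -/

section Substitution

variable {f : ℝ → ℝ}

/-- The derivative `exp (-∫₀ᵗ f)` of `auxF f`. -/
def auxWeight (f : ℝ → ℝ) (t : ℝ) : ℝ := Real.exp (-∫ σ in (0 : ℝ)..t, f σ)

theorem auxWeight_pos (f : ℝ → ℝ) (t : ℝ) : 0 < auxWeight f t := Real.exp_pos _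

theorem contDiff_primitive {g : ℝ → ℝ} (hg : ContDiff ℝ ∞ g) :
    ContDiff ℝ ∞ fun t => ∫ s in (0 : ℝ)..t, g s := by
  have hd : ∀ t, HasDerivAt (fun t => ∫ s in (0 : ℝ)..t, g s) (g t) t := fun t =>
    hg.continuous.integral_hasStrictDerivAt 0 t |>.hasDerivAt
  rw [contDiff_infty_iff_deriv]
  refine ⟨fun t => (hd t).differentiableAt, ?_⟩
  rwa [show deriv (fun t => ∫ s in (0 : ℝ)..t, g s) = g from funext fun t => (hd t).deriv]

theorem contDiff_auxWeight (hf : ContDiff ℝ ∞ f) : ContDiff ℝ ∞ (auxWeight f) :=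
  Real.contDiff_exp.comp (contDiff_primitive hf).neg

theorem contDiff_auxF (hf : ContDiff ℝ ∞ f) : ContDiff ℝ ∞ (auxF f) :=
  contDiff_primitive (contDiff_auxWeight hf)

theorem hasDerivAt_auxWeight (hf : Continuous f) (t : ℝ) :
    HasDerivAt (auxWeight f) (-f t * auxWeight f t) t :=
  (hf.integral_hasStrictDerivAt 0 t).hasDerivAt.neg.exp.congr_deriv (mul_comm _ _)

theorem hasDerivAt_auxF (hf : ContDiff ℝ ∞ f) (t : ℝ) : HasDerivAt (auxF f) (auxWeight f t) t :=
  ((contDiff_auxWeight hf).continuous.integral_hasStrictDerivAt 0 t).hasDerivAt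

theorem strictMono_auxF (hf : ContDiff ℝ ∞ f) : StrictMono (auxF f) :=
  strictMono_of_deriv_pos fun t => by
    rw [(hasDerivAt_auxF hf t).deriv]
    exact auxWeight_pos f t

theorem auxF_zero (f : ℝ → ℝ) : auxF f 0 = 0 := by simp [auxF]

theorem isOpenEmbedding_auxF (hf : ContDiff ℝ ∞ f) : IsOpenEmbedding (auxF f) := by
  refine .of_continuous_injective_isOpenMap (contDiff_auxF hf).continuous
    (strictMono_auxF hf).injective (isOpenMap_of_hasStrictDerivAt (f' := auxWeight f) (fun t => ?_)
      fun t => (auxWeight_pos f t).ne')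
  exact (contDiff_auxWeight hf).continuous.integral_hasStrictDerivAt 0 t

/-- `F` has a left inverse, smooth at the points of the open interval `F(ℝ)`; its values elsewhere
are arbitrary. -/
theorem exists_smooth_inverse_auxF (hf : ContDiff ℝ ∞ f) :
    ∃ G : ℝ → ℝ, (∀ s, G (auxF f s) = s) ∧ ∀ y ∈ range (auxF f), ContDiffAt ℝ ∞ G y := by
  set e := (isOpenEmbedding_auxF hf).toOpenPartialHomeomorph (auxF f)
  have he : ∀ s, e.symm (auxF f s) = s := fun s => e.left_inv (mem_univ s)
  refine ⟨e.symm, he, fun y hy => ?_⟩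
  refine e.contDiffAt_symm_deriv (auxWeight_pos f (e.symm y)).ne' ?_ (hasDerivAt_auxF hf _)
    (contDiff_auxF hf).contDiffAt
  simpa [e] using hy

theorem sq_norm_gradient (g : R3 → ℝ) (x : R3) :
    ‖gradient g x‖ ^ 2 = ∑ i, (fderiv ℝ g x (basisVec i)) ^ 2 := by
  rw [← (EuclideanSpace.basisFun (Fin 3) ℝ).sum_sq_norm_inner_right]
  refine Finset.sum_congr rfl fun i _ => ?_
  rw [real_inner_comm, gradient, InnerProductSpace.toDual_symm_apply, Real.norm_eq_abs, sq_abs]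
  rfl

theorem norm_gradient (g : R3 → ℝ) (x : R3) : ‖gradient g x‖ = ‖fderiv ℝ g x‖ := by
  simp [gradient]

theorem fderiv_space_slice {Φ : ℝ × R3 → ℝ} {t : ℝ} {x : R3} (h : DifferentiableAt ℝ Φ (t, x))
    (w : R3) : fderiv ℝ (fun y => Φ (t, y)) x w = dirDeriv (0, w) Φ (t, x) := by
  have := h.hasFDerivAt.comp x (hasFDerivAt_prodMk_right t x)
  have h2 := this.fderiv
  simp only [Function.comp_def] at h2
  simp [h2, dirDeriv]

theorem contDiffAt_dirDeriv {E : Type*} [NormedAddCommGroup E] [NormedSpace ℝ E] {U : E → ℝ}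
    {p : E} (hU : ContDiffAt ℝ ∞ U p) (v : E) : ContDiffAt ℝ ∞ (dirDeriv v U) p :=
  (hU.fderiv_right (m := ∞) (by simp)).clm_apply contDiffAt_const

theorem laplacian_space_slice {Φ : ℝ × R3 → ℝ} {t : ℝ} {x : R3}
    (h : ∀ᶠ q in 𝓝 (t, x), ContDiffAt ℝ ∞ Φ q) :
    Laplacian.laplacian (fun y => Φ (t, y)) x =
      ∑ i, dirDeriv (spaceVec i) (dirDeriv (spaceVec i) Φ) (t, x) := by
  rw [laplacian_eq_sum_snd]
  refine Finset.sum_congr rfl fun i _ => ?_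
  have hs : ContDiffAt ℝ ∞ (fun y => Φ (t, y)) x :=
    h.self_of_nhds.comp x (contDiffAt_const.prodMk contDiffAt_id)
  rw [← fderiv_dirDeriv hs]
  have hev : dirDeriv (basisVec i) (fun y => Φ (t, y)) =ᶠ[𝓝 x]
      fun y => dirDeriv (spaceVec i) Φ (t, y) := by
    have hc : Tendsto (fun y : R3 => (t, y)) (𝓝 x) (𝓝 (t, x)) :=
      (by fun_prop : Continuous fun y : R3 => (t, y)).tendsto x
    filter_upwards [hc.eventually h] with y hy
    exact fderiv_space_slice (hy.differentiableAt (by simp)) _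
  rw [hev.fderiv_eq]
  exact fderiv_space_slice ((contDiffAt_dirDeriv h.self_of_nhds _).differentiableAt (by simp)) _

theorem dirDeriv_auxF_comp (hf : ContDiff ℝ ∞ f) {E : Type*} [NormedAddCommGroup E]
    [NormedSpace ℝ E] {Φ : E → ℝ} {p : E} (h : DifferentiableAt ℝ Φ p) (v : E) :
    dirDeriv v (fun q => auxF f (Φ q)) p = auxWeight f (Φ p) * dirDeriv v Φ p := by
  have := ((hasDerivAt_auxF hf (Φ p)).comp_hasFDerivAt p h.hasFDerivAt).fderiv
  simp only [Function.comp_def] at this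
  simp [dirDeriv, this]

/-- The second derivatives of `F(Φ)`, by `F'' = -f F'`. -/
theorem dirDeriv_dirDeriv_auxF_comp (hf : ContDiff ℝ ∞ f) {E : Type*} [NormedAddCommGroup E]
    [NormedSpace ℝ E] {Φ : E → ℝ} {p : E} (h : ∀ᶠ q in 𝓝 p, ContDiffAt ℝ ∞ Φ q) (v : E) :
    dirDeriv v (dirDeriv v fun q => auxF f (Φ q)) p =
      auxWeight f (Φ p) * (dirDeriv v (dirDeriv v Φ) p - f (Φ p) * dirDeriv v Φ p ^ 2) := by
  have hev : dirDeriv v (fun q => auxF f (Φ q)) =ᶠ[𝓝 p]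
      fun q => auxWeight f (Φ q) * dirDeriv v Φ q := by
    filter_upwards [h] with q hq
    exact dirDeriv_auxF_comp hf (hq.differentiableAt (by simp)) v
  have h1 := (hasDerivAt_auxWeight hf.continuous (Φ p)).comp_hasFDerivAt p
    (h.self_of_nhds.differentiableAt (by simp)).hasFDerivAt
  have h2 := ((contDiffAt_dirDeriv h.self_of_nhds v).differentiableAt (by simp)).hasFDerivAt
  have h3 := (h1.mul h2).fderiv
  rw [dirDeriv, hev.fderiv_eq]
  simp only [Function.comp_def, Pi.mul_def] at h3
  rw [h3]
  simp only [dirDeriv, add_apply, smul_apply, smul_eq_mul]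
  ring

/-- If `U` is a free wave whose values on `I × ℝ³` lie in the range of `F`, with the data
`(F(u₀), F'(u₀) u₁)`, then `u = F⁻¹(U)` solves the nonlinear problem, because
`□ F(u) = F'(u) (□u - f(u) (u_t² - |∇u|²))` and `F' > 0`. -/
theorem exists_isSmoothSolution_of_box (hf : ContDiff ℝ ∞ f) {u₀ u₁ : R3 → ℝ} {U : ℝ × R3 → ℝ}
    (hU : ContDiff ℝ ∞ U) (hbox : ∀ p, box U p = 0) {I : Set ℝ} (hI : UniqueDiffOn ℝ I)
    (h0 : (0 : ℝ) ∈ I) (hr : ∀ t ∈ I, ∀ x, U (t, x) ∈ range (auxF f))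
    (hU₀ : ∀ x, U (0, x) = auxF f (u₀ x))
    (hU₁ : ∀ x, dirDeriv timeVec U (0, x) = auxWeight f (u₀ x) * u₁ x) :
    ∃ u, IsSmoothSolution f u₀ u₁ I u ∧ ∀ t ∈ I, ∀ x, auxF f (u t x) = U (t, x) := by
  obtain ⟨G, hG, hGs⟩ := exists_smooth_inverse_auxF hf
  set Φ : ℝ × R3 → ℝ := fun p => G (U p) with hΦ
  have hFG : ∀ y ∈ range (auxF f), auxF f (G y) = y := by
    rintro y ⟨s, rfl⟩
    rw [hG]
  have hs : ∀ q, U q ∈ range (auxF f) → ContDiffAt ℝ ∞ Φ q := fun q hq =>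
    (hGs _ hq).comp q hU.contDiffAt
  have hopen : ∀ p, U p ∈ range (auxF f) → ∀ᶠ q in 𝓝 p, U q ∈ range (auxF f) := fun p hp =>
    hU.continuous.continuousAt.eventually ((isOpenEmbedding_auxF hf).isOpen_range.mem_nhds hp)
  have hse : ∀ p, U p ∈ range (auxF f) → ∀ᶠ q in 𝓝 p, ContDiffAt ℝ ∞ Φ q := fun p hp =>
    (hopen p hp).mono hs
  have hUe : ∀ p, U p ∈ range (auxF f) → U =ᶠ[𝓝 p] fun q => auxF f (Φ q) := fun p hp =>
    (hopen p hp).mono fun q hq => (hFG _ hq).symm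
  have ht1 : ∀ t ∈ I, ∀ x, derivWithin (fun s => Φ (s, x)) I t = dirDeriv timeVec Φ (t, x) :=
    fun t ht x => (hasDerivAt_time ((hs _ (hr t ht x)).differentiableAt
      (by simp))).hasDerivWithinAt.derivWithin (hI t ht)
  refine ⟨fun t x => Φ (t, x), ⟨?_, ?_, ?_, ?_⟩, fun t ht x => hFG _ (hr t ht x)⟩
  · rintro ⟨t, x⟩ ⟨ht, -⟩
    exact (hs _ (hr t ht x)).contDiffWithinAt
  · intro t ht x
    have hp := hr t ht x
    have hd := (hs _ hp).differentiableAt (by simp)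
    have ht2 : derivWithin (fun s => derivWithin (fun r => Φ (r, x)) I s) I t =
        dirDeriv timeVec (dirDeriv timeVec Φ) (t, x) := by
      rw [derivWithin_congr (fun s hs => ht1 s hs x) (ht1 t ht x)]
      exact (hasDerivAt_time ((contDiffAt_dirDeriv (hs _ hp) timeVec).differentiableAt
        (by simp))).hasDerivWithinAt.derivWithin (hI t ht)
    have hgrad : ‖gradient (fun y => Φ (t, y)) x‖ ^ 2 =
        ∑ i, dirDeriv (spaceVec i) Φ (t, x) ^ 2 := by
      rw [sq_norm_gradient]
      exact Finset.sum_congr rfl fun i _ => by rw [fderiv_space_slice hd]; rfl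
    have hDD : ∀ v, dirDeriv v (dirDeriv v U) (t, x) = auxWeight f (Φ (t, x)) *
        (dirDeriv v (dirDeriv v Φ) (t, x) - f (Φ (t, x)) * dirDeriv v Φ (t, x) ^ 2) := fun v => by
      rw [← dirDeriv_dirDeriv_auxF_comp hf (hse _ hp)]
      have h1 : dirDeriv v U =ᶠ[𝓝 (t, x)] dirDeriv v fun q => auxF f (Φ q) :=
        ((hUe _ hp).fderiv (𝕜 := ℝ)).mono fun q hq => by simp only [dirDeriv, hq]
      exact DFunLike.congr_fun h1.fderiv_eq v
    have hb := hbox (t, x)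
    simp only [box, hDD, Fin.sum_univ_three] at hb
    rw [← mul_add, ← mul_add, ← mul_sub] at hb
    -- divide the wave equation for `U` by `F'(u) > 0`
    have hb' := (mul_eq_zero.1 hb).resolve_left (auxWeight_pos f _).ne'
    rw [ht2, ht1 t ht x, laplacian_space_slice (hse _ hp), hgrad, Fin.sum_univ_three,
      Fin.sum_univ_three]
    linear_combination hb'
  · intro x
    change G (U (0, x)) = u₀ x
    rw [hU₀, hG]
  · intro x
    have hp := hr 0 h0 x
    have hx : Φ (0, x) = u₀ x := by
      change G (U (0, x)) = u₀ x
      rw [hU₀, hG]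
    rw [ht1 0 h0 x]
    have h1 : dirDeriv timeVec U (0, x) = dirDeriv timeVec (fun q => auxF f (Φ q)) (0, x) := by
      simp only [dirDeriv]
      rw [(hUe _ hp).fderiv_eq]
    rw [hU₁, dirDeriv_auxF_comp hf ((hs _ hp).differentiableAt (by simp)), hx] at h1
    exact (mul_left_cancel₀ (auxWeight_pos f _).ne' h1).symm

end Substitution

/-! ### The transformed data `(F(u₀), F'(u₀) u₁)` -/

section Data

variable {f : ℝ → ℝ} {u₀ u₁ : R3 → ℝ}

/-- The initial position `F(u₀)` of the transformed problem. -/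
def dataPos (f : ℝ → ℝ) (u₀ : R3 → ℝ) (x : R3) : ℝ := auxF f (u₀ x)

/-- The initial velocity `F'(u₀) u₁` of the transformed problem. -/
def dataVel (f : ℝ → ℝ) (u₀ u₁ : R3 → ℝ) (x : R3) : ℝ := auxWeight f (u₀ x) * u₁ x

theorem contDiff_dataPos (hf : ContDiff ℝ ∞ f) (hu₀ : ContDiff ℝ ∞ u₀) :
    ContDiff ℝ ∞ (dataPos f u₀) := (contDiff_auxF hf).comp hu₀

theorem contDiff_dataVel (hf : ContDiff ℝ ∞ f) (hu₀ : ContDiff ℝ ∞ u₀) (hu₁ : ContDiff ℝ ∞ u₁) :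
    ContDiff ℝ ∞ (dataVel f u₀ u₁) := ((contDiff_auxWeight hf).comp hu₀).mul hu₁

theorem norm_fderiv_dataPos (hf : ContDiff ℝ ∞ f) (hu₀ : ContDiff ℝ ∞ u₀) (x : R3) :
    ‖fderiv ℝ (dataPos f u₀) x‖ = auxWeight f (u₀ x) * ‖fderiv ℝ u₀ x‖ := by
  have := ((hasDerivAt_auxF hf (u₀ x)).comp_hasFDerivAt x
    (hu₀.differentiable (by simp) x).hasFDerivAt).fderiv
  have h : fderiv ℝ (dataPos f u₀) x = auxWeight f (u₀ x) • fderiv ℝ u₀ x := this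
  rw [h, norm_smul, Real.norm_of_nonneg (auxWeight_pos f _).le]

theorem norm_fderiv_dataVel (hf : ContDiff ℝ ∞ f) (hu₀ : ContDiff ℝ ∞ u₀) (hu₁ : ContDiff ℝ ∞ u₁)
    (x : R3) : ‖fderiv ℝ (dataVel f u₀ u₁) x‖ = auxWeight f (u₀ x) *
      ‖gradient u₁ x - (f (u₀ x) * u₁ x) • gradient u₀ x‖ := by
  have h1 := (hasDerivAt_auxWeight hf.continuous (u₀ x)).comp_hasFDerivAt x
    (hu₀.differentiable (by simp) x).hasFDerivAt
  have h2 : fderiv ℝ (dataVel f u₀ u₁) x = _ :=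
    (h1.mul (hu₁.differentiable (by simp) x).hasFDerivAt).fderiv
  have h3 : fderiv ℝ (dataVel f u₀ u₁) x = auxWeight f (u₀ x) •
      (fderiv ℝ u₁ x - (f (u₀ x) * u₁ x) • fderiv ℝ u₀ x) := by
    rw [h2]
    ext w
    simp only [Function.comp_def, add_apply, sub_apply, smul_apply, smul_eq_mul]
    ring
  rw [h3, norm_smul, Real.norm_of_nonneg (auxWeight_pos f _).le]
  simp only [gradient, ← map_smul, ← map_sub, LinearIsometryEquiv.norm_map]

/-- With `norm_fderiv_dataPos` and `norm_fderiv_dataVel`: the conditions on `(u₀, u₁)` are those on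
the transformed data divided by `F'(u₀) > 0`. -/
theorem laplacian_dataPos (hf : ContDiff ℝ ∞ f) (hu₀ : ContDiff ℝ ∞ u₀) (x : R3) :
    Laplacian.laplacian (dataPos f u₀) x = auxWeight f (u₀ x) *
      (Laplacian.laplacian u₀ x - f (u₀ x) * ‖gradient u₀ x‖ ^ 2) := by
  have h : ∀ v, dirDeriv v (dirDeriv v (dataPos f u₀)) x = _ := fun v =>
    dirDeriv_dirDeriv_auxF_comp hf (Eventually.of_forall fun q => hu₀.contDiffAt (x := q)) v
  rw [laplacian_eq_sum (contDiff_dataPos hf hu₀), laplacian_eq_sum hu₀, sq_norm_gradient]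
  simp only [h, Fin.sum_univ_three]
  simp only [dirDeriv]
  ring

theorem tendsto_dataPos (hf : ContDiff ℝ ∞ f) (h : Tendsto u₀ (cocompact R3) (𝓝 0)) :
    Tendsto (dataPos f u₀) (cocompact R3) (𝓝 0) := by
  have := ((contDiff_auxF hf).continuous.tendsto 0).comp h
  rwa [auxF_zero] at this

theorem tendsto_dataVel (hf : ContDiff ℝ ∞ f) (h : Tendsto u₀ (cocompact R3) (𝓝 0))
    (h' : Tendsto u₁ (cocompact R3) (𝓝 0)) :
    Tendsto (dataVel f u₀ u₁) (cocompact R3) (𝓝 0) := by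
  have := (((contDiff_auxWeight hf).continuous.tendsto 0).comp h).mul h'
  rwa [mul_zero] at this

/-- The free wave with transformed data is bounded when the data decay and are in the Lorentz
class. Since `F'(u₀)` is bounded, only the derivatives of `∇u₀` and `u₁` enter, not those of the
transformed data. -/
theorem exists_bound_freeWave_data (hf : ContDiff ℝ ∞ f) (hu₀ : ContDiff ℝ ∞ u₀)
    (hu₁ : ContDiff ℝ ∞ u₁) (hd₀ : DecaysAtInfinity u₀) (hd₁ : DecaysAtInfinity u₁)
    (hL : LorentzData u₀ u₁) :
    ∃ C, ∀ p, |freeWave (dataPos f u₀) (dataVel f u₀ u₁) p| ≤ C := by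
  have hfd : ContDiff ℝ ∞ (fderiv ℝ u₀) := hu₀.fderiv_right (by simp)
  have hfd0 : Tendsto (fderiv ℝ u₀) (cocompact R3) (𝓝 0) := by
    rw [tendsto_zero_iff_norm_tendsto_zero]
    simpa only [norm_gradient] using tendsto_zero_iff_norm_tendsto_zero.1 hd₀.2
  obtain ⟨C₀, hC₀⟩ := exists_bound_sphericalMean_norm (hfd.of_le (by simp)) hfd0
    (k := iteratedFDeriv ℝ 2 u₀) (fun y => by
      rw [← norm_iteratedFDeriv_fderiv (n := 1), norm_iteratedFDeriv_one]) hL.1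
  obtain ⟨C₁, hC₁⟩ := exists_bound_sphericalMean_norm (hu₁.of_le (by simp)) hd₁.1
    (k := gradient u₁) (fun y => norm_gradient u₁ y) hL.2
  obtain ⟨B, -, hB⟩ := exists_bound_of_tendsto_cocompact (contDiff_dataPos hf hu₀).continuous
    (tendsto_dataPos hf hd₀.1)
  have hw : Tendsto (fun x => auxWeight f (u₀ x) - auxWeight f 0) (cocompact R3) (𝓝 0) := by
    have := ((contDiff_auxWeight hf).continuous.tendsto 0).comp hd₀.1
    simpa using this.sub_const (auxWeight f 0)
  obtain ⟨A, hA, hA'⟩ := exists_bound_of_tendsto_cocompact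
    (((contDiff_auxWeight hf).continuous.comp hu₀.continuous).sub continuous_const) hw
  have hA0 := auxWeight_pos f 0
  have hwA : ∀ x, auxWeight f (u₀ x) ≤ A + auxWeight f 0 := fun x => by
    have := (abs_le.1 (hA' x)).2
    change auxWeight f (u₀ x) - auxWeight f 0 ≤ A at this
    linarith
  refine exists_bound_freeWave (contDiff_dataPos hf hu₀) hfd.continuous hu₁.continuous
    (A := A + auxWeight f 0) (by positivity) hB (fun y => ?_) (fun y => ?_) hC₀ hC₁
  · rw [norm_fderiv_dataPos hf hu₀]
    exact mul_le_mul_of_nonneg_right (hwA y) (norm_nonneg _)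
  · rw [dataVel, abs_mul, abs_of_pos (auxWeight_pos f _)]
    exact mul_le_mul_of_nonneg_right (hwA y) (abs_nonneg _)

theorem exists_isSmoothSolution_of_mem_range (hf : ContDiff ℝ ∞ f) (hu₀ : ContDiff ℝ ∞ u₀)
    (hu₁ : ContDiff ℝ ∞ u₁) {I : Set ℝ} (hI : UniqueDiffOn ℝ I) (h0 : (0 : ℝ) ∈ I)
    (hr : ∀ t ∈ I, ∀ x, freeWave (dataPos f u₀) (dataVel f u₀ u₁) (t, x) ∈ range (auxF f)) :
    ∃ u, IsSmoothSolution f u₀ u₁ I u ∧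
      ∀ t ∈ I, ∀ x, auxF f (u t x) = freeWave (dataPos f u₀) (dataVel f u₀ u₁) (t, x) :=
  have h₀ := contDiff_dataPos hf hu₀
  have h₁ := contDiff_dataVel hf hu₀ hu₁
  exists_isSmoothSolution_of_box hf (contDiff_freeWave h₀ h₁) (box_freeWave h₀ h₁) hI h0 hr
    (fun x => freeWave_zero_time h₀ x) (fun x => dirDeriv_time_freeWave_zero_time h₀ h₁ x)

theorem freeWave_neg {v₀ v₁ : R3 → ℝ} (h₀ : ContDiff ℝ ∞ v₀) (p : ℝ × R3) :
    freeWave (-v₀) (-v₁) p = -freeWave v₀ v₁ p := by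
  have h₀' : ContDiff ℝ ∞ (-v₀) := h₀.neg
  rw [freeWave_eq h₀', freeWave_eq h₀]
  simp only [sphericalMean, normalMean, Pi.neg_apply, fderiv_neg, neg_apply, integral_neg]
  ring

theorem mem_range_auxF_of_ge (hf : ContDiff ℝ ∞ f) (hT : Tendsto (auxF f) atTop atTop) {s y : ℝ}
    (h : auxF f s ≤ y) : y ∈ range (auxF f) :=
  mem_range_of_exists_le_of_exists_ge (contDiff_auxF hf).continuous ⟨s, h⟩
    (hT.eventually_ge_atTop y).exists

theorem mem_range_auxF_of_le (hf : ContDiff ℝ ∞ f) (hT : Tendsto (auxF f) atBot atBot) {s y : ℝ}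
    (h : y ≤ auxF f s) : y ∈ range (auxF f) :=
  mem_range_of_exists_le_of_exists_ge (contDiff_auxF hf).continuous
    (hT.eventually_le_atBot y).exists ⟨s, h⟩

theorem exists_upper_bound (hf : ContDiff ℝ ∞ f) (hT : Tendsto (auxF f) atTop atTop) (C : ℝ) :
    ∃ s, ∀ y, auxF f y ≤ C → y ≤ s := by
  obtain ⟨s, hs⟩ := (hT.eventually_ge_atTop C).exists
  exact ⟨s, fun y hy => (strictMono_auxF hf).le_iff_le.1 (hy.trans hs)⟩

theorem exists_lower_bound (hf : ContDiff ℝ ∞ f) (hT : Tendsto (auxF f) atBot atBot) (C : ℝ) :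
    ∃ s, ∀ y, C ≤ auxF f y → s ≤ y := by
  obtain ⟨s, hs⟩ := (hT.eventually_le_atBot C).exists
  exact ⟨s, fun y hy => (strictMono_auxF hf).le_iff_le.1 (hs.trans hy)⟩

/-! ### Solutions of the nonlinear problem -/

theorem exists_global_solution (hf : ContDiff ℝ ∞ f) (hu₀ : ContDiff ℝ ∞ u₀)
    (hu₁ : ContDiff ℝ ∞ u₁) (hB : Tendsto (auxF f) atBot atBot)
    (hT : Tendsto (auxF f) atTop atTop) :
    ∃ u : ℝ → R3 → ℝ, IsSmoothSolution f u₀ u₁ univ u ∧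
      (DecaysAtInfinity u₀ → DecaysAtInfinity u₁ → LorentzData u₀ u₁ → IsBoundedSpacetime u) := by
  obtain ⟨u, hu, hFu⟩ := exists_isSmoothSolution_of_mem_range hf hu₀ hu₁ uniqueDiffOn_univ
    (mem_univ 0) fun t _ x => (contDiff_auxF hf).continuous.surjective hT hB _
  refine ⟨u, hu, fun hd₀ hd₁ hL => ?_⟩
  obtain ⟨C, hC⟩ := exists_bound_freeWave_data hf hu₀ hu₁ hd₀ hd₁ hL
  obtain ⟨s, hs⟩ := exists_upper_bound hf hT C
  obtain ⟨r, hr⟩ := exists_lower_bound hf hB (-C)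
  refine ⟨max |r| |s|, fun t x => abs_le_max_abs_abs (hr _ ?_) (hs _ ?_)⟩
  · rw [hFu t (mem_univ t)]; exact (abs_le.1 (hC _)).1
  · rw [hFu t (mem_univ t)]; exact (abs_le.1 (hC _)).2

theorem exists_forward_solution_ge (hf : ContDiff ℝ ∞ f) (hu₀ : ContDiff ℝ ∞ u₀)
    (hu₁ : ContDiff ℝ ∞ u₁) (hT : Tendsto (auxF f) atTop atTop) (hb : BddBelow (range u₀))
    (hv : ∀ x, ‖gradient u₀ x‖ ≤ u₁ x) :
    ∃ u : ℝ → R3 → ℝ, IsSmoothSolution f u₀ u₁ (Ici 0) u ∧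
      ∀ t, 0 ≤ t → ∀ x, ⨅ y, u₀ y ≤ u t x := by
  have hge : ∀ t, 0 ≤ t → ∀ x,
      auxF f (⨅ y, u₀ y) ≤ freeWave (dataPos f u₀) (dataVel f u₀ u₁) (t, x) := fun t ht x => by
    refine le_freeWave_of_gradient_le (contDiff_dataPos hf hu₀) (contDiff_dataVel hf hu₀ hu₁)
      (fun y => (strictMono_auxF hf).monotone (ciInf_le hb y)) (fun y => ?_) ht x
    rw [norm_fderiv_dataPos hf hu₀, dataVel, ← norm_gradient]
    exact mul_le_mul_of_nonneg_left (hv y) (auxWeight_pos f _).le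
  obtain ⟨u, hu, hFu⟩ := exists_isSmoothSolution_of_mem_range hf hu₀ hu₁ (uniqueDiffOn_Ici 0)
    self_mem_Ici fun t ht x => mem_range_auxF_of_ge hf hT (hge t ht x)
  refine ⟨u, hu, fun t ht x => (strictMono_auxF hf).le_iff_le.1 ?_⟩
  rw [hFu t ht]
  exact hge t ht x

theorem exists_forward_solution_le (hf : ContDiff ℝ ∞ f) (hu₀ : ContDiff ℝ ∞ u₀)
    (hu₁ : ContDiff ℝ ∞ u₁) (hB : Tendsto (auxF f) atBot atBot) (hb : BddAbove (range u₀))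
    (hv : ∀ x, u₁ x ≤ -‖gradient u₀ x‖) :
    ∃ u : ℝ → R3 → ℝ, IsSmoothSolution f u₀ u₁ (Ici 0) u ∧
      ∀ t, 0 ≤ t → ∀ x, u t x ≤ ⨆ y, u₀ y := by
  have hle : ∀ t, 0 ≤ t → ∀ x,
      freeWave (dataPos f u₀) (dataVel f u₀ u₁) (t, x) ≤ auxF f (⨆ y, u₀ y) := fun t ht x => by
    have h := le_freeWave_of_gradient_le (v₀ := -dataPos f u₀) (v₁ := -dataVel f u₀ u₁)
      (m := -auxF f (⨆ y, u₀ y)) (contDiff_dataPos hf hu₀).neg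
      (contDiff_dataVel hf hu₀ hu₁).neg
      (fun y => neg_le_neg ((strictMono_auxF hf).monotone (le_ciSup hb y))) (fun y => ?_) ht x
    · rw [freeWave_neg (contDiff_dataPos hf hu₀)] at h
      exact neg_le_neg_iff.1 h
    · rw [fderiv_neg, norm_neg, norm_fderiv_dataPos hf hu₀, ← norm_gradient, Pi.neg_apply, dataVel,
        ← mul_neg]
      exact mul_le_mul_of_nonneg_left (le_neg_of_le_neg (hv y)) (auxWeight_pos f _).le
  obtain ⟨u, hu, hFu⟩ := exists_isSmoothSolution_of_mem_range hf hu₀ hu₁ (uniqueDiffOn_Ici 0)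
    self_mem_Ici fun t ht x => mem_range_auxF_of_le hf hB (hle t ht x)
  refine ⟨u, hu, fun t ht x => (strictMono_auxF hf).le_iff_le.1 ?_⟩
  rw [hFu t ht]
  exact hle t ht x

theorem exists_global_solution_nonneg (hf : ContDiff ℝ ∞ f) (hu₀ : ContDiff ℝ ∞ u₀)
    (hu₁ : ContDiff ℝ ∞ u₁) (hT : Tendsto (auxF f) atTop atTop) (hd₀ : DecaysAtInfinity u₀)
    (hd₁ : DecaysAtInfinity u₁)
    (hl : ∀ x, ‖gradient u₁ x - (f (u₀ x) * u₁ x) • gradient u₀ x‖ ≤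
      -Laplacian.laplacian u₀ x + f (u₀ x) * ‖gradient u₀ x‖ ^ 2) :
    ∃ u : ℝ → R3 → ℝ, IsSmoothSolution f u₀ u₁ univ u ∧ (∀ t x, 0 ≤ u t x) ∧
      (LorentzData u₀ u₁ → IsBoundedSpacetime u) := by
  have hge : ∀ t x, auxF f 0 ≤ freeWave (dataPos f u₀) (dataVel f u₀ u₁) (t, x) := fun t x => by
    rw [auxF_zero]
    refine freeWave_nonneg_of_laplacian (contDiff_dataPos hf hu₀) (contDiff_dataVel hf hu₀ hu₁)
      (fun y => ?_) (tendsto_dataPos hf hd₀.1) (tendsto_dataVel hf hd₀.1 hd₁.1) t x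
    rw [norm_fderiv_dataVel hf hu₀ hu₁, laplacian_dataPos hf hu₀, ← mul_neg]
    exact mul_le_mul_of_nonneg_left ((hl y).trans_eq (by ring)) (auxWeight_pos f _).le
  obtain ⟨u, hu, hFu⟩ := exists_isSmoothSolution_of_mem_range hf hu₀ hu₁ uniqueDiffOn_univ
    (mem_univ 0) fun t _ x => mem_range_auxF_of_ge hf hT (hge t x)
  have hu0 : ∀ t x, 0 ≤ u t x := fun t x => (strictMono_auxF hf).le_iff_le.1 (by
    rw [hFu t (mem_univ t)]; exact hge t x)
  refine ⟨u, hu, hu0, fun hL => ?_⟩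
  obtain ⟨C, hC⟩ := exists_bound_freeWave_data hf hu₀ hu₁ hd₀ hd₁ hL
  obtain ⟨s, hs⟩ := exists_upper_bound hf hT C
  refine ⟨s, fun t x => ?_⟩
  rw [abs_of_nonneg (hu0 t x)]
  refine hs _ ?_
  rw [hFu t (mem_univ t)]
  exact (abs_le.1 (hC _)).2

theorem exists_global_solution_nonpos (hf : ContDiff ℝ ∞ f) (hu₀ : ContDiff ℝ ∞ u₀)
    (hu₁ : ContDiff ℝ ∞ u₁) (hB : Tendsto (auxF f) atBot atBot) (hd₀ : DecaysAtInfinity u₀)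
    (hd₁ : DecaysAtInfinity u₁)
    (hl : ∀ x, ‖gradient u₁ x - (f (u₀ x) * u₁ x) • gradient u₀ x‖ ≤
      Laplacian.laplacian u₀ x - f (u₀ x) * ‖gradient u₀ x‖ ^ 2) :
    ∃ u : ℝ → R3 → ℝ, IsSmoothSolution f u₀ u₁ univ u ∧ (∀ t x, u t x ≤ 0) ∧
      (LorentzData u₀ u₁ → IsBoundedSpacetime u) := by
  have hle : ∀ t x, freeWave (dataPos f u₀) (dataVel f u₀ u₁) (t, x) ≤ auxF f 0 := fun t x => by
    have h := freeWave_nonneg_of_laplacian (v₀ := -dataPos f u₀) (v₁ := -dataVel f u₀ u₁)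
      (contDiff_dataPos hf hu₀).neg
      (contDiff_dataVel hf hu₀ hu₁).neg (fun y => ?_)
      (neg_zero (G := ℝ) ▸ (tendsto_dataPos hf hd₀.1).neg)
      (neg_zero (G := ℝ) ▸ (tendsto_dataVel hf hd₀.1 hd₁.1).neg) t x
    · rw [freeWave_neg (contDiff_dataPos hf hu₀)] at h
      rw [auxF_zero]
      exact neg_nonneg.1 h
    · rw [fderiv_neg, norm_neg, norm_fderiv_dataVel hf hu₀ hu₁, InnerProductSpace.laplacian_neg,
        Pi.neg_apply, neg_neg, laplacian_dataPos hf hu₀]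
      exact mul_le_mul_of_nonneg_left (hl y) (auxWeight_pos f _).le
  obtain ⟨u, hu, hFu⟩ := exists_isSmoothSolution_of_mem_range hf hu₀ hu₁ uniqueDiffOn_univ
    (mem_univ 0) fun t _ x => mem_range_auxF_of_le hf hB (hle t x)
  have hu0 : ∀ t x, u t x ≤ 0 := fun t x => (strictMono_auxF hf).le_iff_le.1 (by
    rw [hFu t (mem_univ t)]; exact hle t x)
  refine ⟨u, hu, hu0, fun hL => ?_⟩
  obtain ⟨C, hC⟩ := exists_bound_freeWave_data hf hu₀ hu₁ hd₀ hd₁ hL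
  obtain ⟨s, hs⟩ := exists_lower_bound hf hB (-C)
  refine ⟨-s, fun t x => ?_⟩
  rw [abs_of_nonpos (hu0 t x)]
  refine neg_le_neg (hs _ ?_)
  rw [hFu t (mem_univ t)]
  exact (abs_le.1 (hC _)).1

end Data

end NullForm

end

theorem mainTheorem7 (f : ℝ → ℝ) (hf : ContDiff ℝ ∞ f) (u₀ u₁ : NullForm.R3 → ℝ)
    (hu₀ : ContDiff ℝ ∞ u₀) (hu₁ : ContDiff ℝ ∞ u₁) :
    -- `F(±∞) = ±∞`
    (Tendsto (NullForm.auxF f) atBot atBot → Tendsto (NullForm.auxF f) atTop atTop →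
      ∃ u : ℝ → NullForm.R3 → ℝ, NullForm.IsSmoothSolution f u₀ u₁ univ u ∧
        (NullForm.DecaysAtInfinity u₀ → NullForm.DecaysAtInfinity u₁ →
          NullForm.LorentzData u₀ u₁ → NullForm.IsBoundedSpacetime u)) ∧
    -- `F(-∞) = a ∈ ℝ`, `F(+∞) = +∞`
    (∀ a : ℝ, Tendsto (NullForm.auxF f) atBot (𝓝 a) → Tendsto (NullForm.auxF f) atTop atTop →
      (BddBelow (range u₀) → (∀ x, ‖gradient u₀ x‖ ≤ u₁ x) →
        ∃ u : ℝ → NullForm.R3 → ℝ, NullForm.IsSmoothSolution f u₀ u₁ (Ici 0) u ∧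
          ∀ t, 0 ≤ t → ∀ x, ⨅ y, u₀ y ≤ u t x) ∧
      (NullForm.DecaysAtInfinity u₀ → NullForm.DecaysAtInfinity u₁ →
        (∀ x, ‖gradient u₁ x - (f (u₀ x) * u₁ x) • gradient u₀ x‖ ≤
          -Laplacian.laplacian u₀ x + f (u₀ x) * ‖gradient u₀ x‖ ^ 2) →
        ∃ u : ℝ → NullForm.R3 → ℝ, NullForm.IsSmoothSolution f u₀ u₁ univ u ∧
          (∀ t x, 0 ≤ u t x) ∧
          (NullForm.LorentzData u₀ u₁ → NullForm.IsBoundedSpacetime u))) ∧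
    -- `F(-∞) = -∞`, `F(+∞) = b ∈ ℝ`
    (∀ b : ℝ, Tendsto (NullForm.auxF f) atBot atBot → Tendsto (NullForm.auxF f) atTop (𝓝 b) →
      (BddAbove (range u₀) → (∀ x, u₁ x ≤ -‖gradient u₀ x‖) →
        ∃ u : ℝ → NullForm.R3 → ℝ, NullForm.IsSmoothSolution f u₀ u₁ (Ici 0) u ∧
          ∀ t, 0 ≤ t → ∀ x, u t x ≤ ⨆ y, u₀ y) ∧
      (NullForm.DecaysAtInfinity u₀ → NullForm.DecaysAtInfinity u₁ →
        (∀ x, ‖gradient u₁ x - (f (u₀ x) * u₁ x) • gradient u₀ x‖ ≤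
          Laplacian.laplacian u₀ x - f (u₀ x) * ‖gradient u₀ x‖ ^ 2) →
        ∃ u : ℝ → NullForm.R3 → ℝ, NullForm.IsSmoothSolution f u₀ u₁ univ u ∧
          (∀ t x, u t x ≤ 0) ∧
          (NullForm.LorentzData u₀ u₁ → NullForm.IsBoundedSpacetime u))) := by
  refine ⟨NullForm.exists_global_solution hf hu₀ hu₁, fun _ _ hT => ⟨?_, ?_⟩,
    fun _ hB _ => ⟨?_, ?_⟩⟩
  · exact NullForm.exists_forward_solution_ge hf hu₀ hu₁ hT
  · exact NullForm.exists_global_solution_nonneg hf hu₀ hu₁ hT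
  · exact NullForm.exists_forward_solution_le hf hu₀ hu₁ hB
  · exact NullForm.exists_global_solution_nonpos hf hu₀ hu₁ hB
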